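/- Let $M$ be a smooth manifold (Hausdorff, second countable, without boundary, of finite dimension). Put $T^0M=M$ and $T^{r+1}M=T(T^rM)$, with canonical projections $\pi_r\colon T^{r+1}M\to T^rM$; $T^{r+1}M$ is regarded as a vector bundle over $T^rM$ via $\pi_r$. Write $D\phi$ for the tangent map of $\phi$, and $\gamma'$ for the tangent curve of a smooth curve $\gamma$. Let $T^0M\setminus 0=M$, and for $r\ge 1$ let $T^rM\setminus 0$ be the open set of all $\xi\in T^rM$ such that $D(\pi_{T^{r-1}M\to M})(\xi)\in TM$ is a nonzero vector. Let $\kappa_1=\operatorname{id}_{TM}$, and for $r\ge 2$ let $\kappa_r\colon T^rM\to T^rM$ be the canonical involution, characterized by $\partial_t\partial_s c=\kappa_r\circ\partial_s\partial_t c$ for all smooth maps $c(t,s)$ into $T^{r-2}M$. For $r\ge 1$ let $E_r$ be the Liouville vector field on $T^rM$, $E_r(\xi)=\partial_s((1+s)\xi)|_{s=0}$. A spray on $T^rM$ is a smooth vector field $S$ on $T^{r+1}M\setminus 0$ with $D\pi_r\circ S=\operatorname{id}$ and $[E_{r+1},S]=S$. Its complete lift is $S^c=D\kappa_{r+2}\circ\kappa_{r+3}\circ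 DS\circ\kappa_{r+2}$, a spray on $T^{r+1}M$. A geodesic of $S$ is a smooth curve $\gamma\colon I\to T^rM$ on an open interval $I$ such that $\gamma'(t)\in T^{r+1}M\setminus 0$ and $\gamma''(t)=S(\gamma'(t))$ for all $t\in I$. Let $S^0$ be a spray on $M$, and let $S^{r}=(S^{r-1})^c$ for $r\ge 1$, so that $S^r$ is a spray on $T^rM$. Suppose that $j\colon I\to T^rM$ is a geodesic of $S^r$. Then: 1. If $r\ge 0$, $t_0\in\mathbb R$ and $C>0$, then $t\mapsto j(Ct+t_0)$, defined on $\{t : Ct+t_0\in I\}$, is a geodesic of $S^r$. 2. If $r\ge 1$ and $k\colon I\to T^rM$ is another geodesic of $S^r$ with $\pi_{r-1}\circ j=\pi_{r-1}\circ k$, then $\alpha j+\beta k$ is a geodesic of $S^r$ for all $\alpha,\beta\in\mathbb R$. 3. If $r\ge 1$, then $\kappa_r\circ j\colon I\to T^rM$ is a geodesic of $S^r$. 4. If $r\ge 1$, then $\pi_{r-1}\circ j\colon I\to T^{r-1}M$ is a geodesic of $S^{r-1}$. 5. If $r\ge 2$, then $D\pi_{r-2}\circ j\colon I\to T^{r-1}M$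 is a geodesic of $S^{r-1}$. 6. If $r\ge 0$, then $j'\colon I\to T^{r+1}M$ is a geodesic of $S^{r+1}$. 7. If $r\ge 0$, then $t\mapsto t\,j'(t)$, $I\to T^{r+1}M$, is a geodesic of $S^{r+1}$. 8. If $r\ge 1$, then $E_r\circ j\colon I\to T^{r+1}M$ is a geodesic of $S^{r+1}$. -/

import Mathlib

open scoped Manifold ContDiff

noncomputable section

namespace IteratedTangent

universe u

/-- Finite-dimensional smooth manifolds without boundary, with the model data bundled so that the
tangent bundle construction can be iterated. -/
structure Mfd where
  /-- the model vector space -/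
  E : Type
  [normedAddCommGroup : NormedAddCommGroup E]
  [normedSpace : NormedSpace ℝ E]
  [finiteDimensional : FiniteDimensional ℝ E]
  /-- the model space of the charts -/
  H : Type
  [topologicalSpaceModel : TopologicalSpace H]
  /-- the model embedding -/
  I : ModelWithCorners ℝ E H
  [boundaryless : I.Boundaryless]
  /-- the underlying type of points -/
  M : Type u
  [topologicalSpace : TopologicalSpace M]
  [chartedSpace : ChartedSpace H M]
  [isManifold : IsManifold I ∞ M]

attribute [instance] Mfd.normedAddCommGroup Mfd.normedSpace Mfd.finiteDimensional
  Mfd.topologicalSpaceModel Mfd.boundaryless Mfd.topologicalSpace Mfd.chartedSpace Mfd.isManifold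

/-- The tangent bundle `TX`, as a manifold. -/
abbrev Mfd.T (X : Mfd.{u}) : Mfd.{u} where
  E := X.E × X.E
  H := ModelProd X.H X.E
  I := X.I.tangent
  M := TangentBundle X.I X.M

/-- The iterated tangent bundle `T^r X`. -/
def Mfd.iter (X : Mfd.{u}) : ℕ → Mfd.{u}
  | 0 => X
  | r + 1 => (Mfd.iter X r).T

/-- A smooth manifold of dimension `n`, as an object of `Mfd`. -/
abbrev ofManifold (n : ℕ) (M : Type u) [TopologicalSpace M]
    [ChartedSpace (EuclideanSpace ℝ (Fin n)) M] [IsManifold (𝓡 n) ∞ M] : Mfd.{u} where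
  E := EuclideanSpace ℝ (Fin n)
  H := EuclideanSpace ℝ (Fin n)
  I := 𝓡 n
  M := M

/-- The tangent map `Df : TX → TY`. -/
def D {X Y : Mfd.{u}} (f : X.M → Y.M) : X.T.M → Y.T.M := tangentMap X.I Y.I f

/-- The tangent `γ' : ℝ → TX` of a curve in `X`. -/
def tangent {X : Mfd.{u}} (γ : ℝ → X.M) (t : ℝ) : X.T.M :=
  ⟨γ t, mfderiv 𝓘(ℝ, ℝ) X.I γ t (1 : ℝ)⟩

/-- The component at `p` of a tangent vector `η`: it is the vector `η` itself if `η` is based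
at `p` (the only case that matters), and `0` otherwise. -/
def vecAt {X : Mfd.{u}} (p : X.M) (η : X.T.M) : TangentSpace X.I p :=
  open Classical in if h : η.proj = p then h ▸ η.snd else 0

/-- `c • ξ` in the vector bundle `TX → X`. -/
def fibreSMul {X : Mfd.{u}} (c : ℝ) (ξ : X.T.M) : X.T.M := ⟨ξ.proj, c • ξ.snd⟩

/-- `α ξ + β η` in the vector bundle `TX → X`, for `ξ`, `η` in the same fibre. -/
def fibreComb {X : Mfd.{u}} (α β : ℝ) (ξ η : X.T.M) : X.T.M :=
  ⟨ξ.proj, α • ξ.snd + β • vecAt ξ.proj η⟩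

/-- The Liouville vector field on `TX`, as a map: `E(ξ) = ∂ₛ ((1 + s) ξ)` at `s = 0`. -/
def liouville {X : Mfd.{u}} (ξ : X.T.M) : X.T.T.M :=
  tangent (X := X.T) (fun s : ℝ => fibreSMul (1 + s) ξ) 0

/-- The canonical flip `(x, y, X, Y) ↦ (x, X, y, Y)` of `TTX`. In Mathlib the coordinates of the
fibre of `TTX` over `(x, y) ∈ TX` are those of the chart of `TX` induced by the preferred chart
of `X` at `x`; so the points `(x, y)` and `(x, X)` of `TX` use the same induced coordinates. The flip satisfies
`∂ₜ ∂ₛ c = canonicalFlip ∘ ∂ₛ ∂ₜ c`, see `canonicalFlip_spec`. -/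
def canonicalFlip {X : Mfd.{u}} (ξ : X.T.T.M) : X.T.T.M :=
  let y : X.E := ξ.proj.snd
  let w : X.E × X.E := ξ.snd
  ⟨⟨ξ.proj.proj, w.1⟩, (y, w.2)⟩

section FlipCharacterization

open Filter Topology

theorem extChartAt_tangent {X : Mfd.{u}} (q : X.T.M) (γ : ℝ → X.M) (t : ℝ)
    (hs : γ t ∈ (chartAt X.H q.proj).source) (hγ : MDifferentiableAt 𝓘(ℝ, ℝ) X.I γ t) :
    extChartAt X.T.I q (tangent γ t) =
      (extChartAt X.I q.proj (γ t), deriv (extChartAt X.I q.proj ∘ γ) t) := by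
  have h1 : extChartAt X.T.I q (tangent γ t) = (extChartAt X.I q.proj (γ t),
     (trivializationAt X.E (TangentSpace X.I) q.proj).continuousLinearMapAt ℝ (γ t)
        (mfderiv 𝓘(ℝ, ℝ) X.I γ t (1 : ℝ))) := by
    rw [TangentBundle.continuousLinearMapAt_trivializationAt_eq_core hs]
    rfl
  rw [h1, TangentBundle.continuousLinearMapAt_trivializationAt hs]
  congr 1
  have h2 : MDifferentiableAt X.I 𝓘(ℝ, X.E) (extChartAt X.I q.proj) (γ t) :=
    mdifferentiableAt_extChartAt hs
  have h3 := mfderiv_comp t h2 hγ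
  rw [mfderiv_eq_fderiv] at h3
  rw [← fderiv_apply_one_eq_deriv, h3]
  rfl

theorem tangent_eq {X : Mfd.{u}} (γ : ℝ → X.M) (t : ℝ) (v : X.E) (hc : ContinuousAt γ t)
    (hd : HasDerivAt (extChartAt X.I (γ t) ∘ γ) v t) :
    tangent γ t = ⟨γ t, v⟩ := by
  have : HasMFDerivAt 𝓘(ℝ, ℝ) X.I γ t (ContinuousLinearMap.toSpanSingleton ℝ v : ℝ →L[ℝ] X.E) := by
    refine ⟨hc, ?_⟩
    have := hd.hasFDerivAt.hasFDerivWithinAt (s := Set.univ)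
    rw [ModelWithCorners.range_eq_univ]
    simp only [writtenInExtChartAt, extChartAt_model_space_eq_id]
    exact this
  unfold tangent
  rw [this.mfderiv]
  congr 1
  exact one_smul ℝ v

theorem continuousAt_of_chart {X : Mfd.{u}} (Γ : ℝ → X.T.M) (t : ℝ)
    (hs : ContinuousAt (fun a => (Γ a).proj) t)
    (h : ContinuousAt (fun a => extChartAt X.T.I (Γ t) (Γ a)) t) : ContinuousAt Γ t := by
  have h1 : ∀ᶠ a in 𝓝 t, Γ a ∈ (extChartAt X.T.I (Γ t)).source := by
    have := hs.preimage_mem_nhds ((chartAt X.H (Γ t).proj).open_source.mem_nhds (mem_chart_source _ _))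
    filter_upwards [this] with a ha
    rw [extChartAt_source, TangentBundle.mem_chart_source_iff]
    exact ha
  have h2 : ContinuousAt (fun a => (extChartAt X.T.I (Γ t)).symm (extChartAt X.T.I (Γ t) (Γ a))) t :=
    ContinuousAt.comp (g := (extChartAt X.T.I (Γ t)).symm) (continuousAt_extChartAt_symm _) h
  refine h2.congr ?_
  filter_upwards [h1] with a ha
  exact (extChartAt X.T.I (Γ t)).left_inv ha

theorem tangent_tangent {X : Mfd.{u}} (c : ℝ × ℝ → X.M) (P : ℝ → ℝ → ℝ × ℝ) (u v : ℝ × ℝ)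
    (hu : ∀ a b, HasDerivAt (fun a => P a b) u a) (hv : ∀ a b, HasDerivAt (fun b => P a b) v b)
    (a b : ℝ) (hc : ContMDiffAt 𝓘(ℝ, ℝ × ℝ) X.I ∞ c (P a b)) :
    tangent (X := X.T) (fun a => tangent (fun b => c (P a b)) b) a =
      (⟨⟨c (P a b), fderiv ℝ (extChartAt X.I (c (P a b)) ∘ c) (P a b) v⟩,
        (fderiv ℝ (extChartAt X.I (c (P a b)) ∘ c) (P a b) u,
        fderiv ℝ (fderiv ℝ (extChartAt X.I (c (P a b)) ∘ c)) (P a b) u v)⟩ : X.T.T.M) := by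
  set F := extChartAt X.I (c (P a b)) ∘ c with hF
  have hFs : ContDiffAt ℝ ∞ F (P a b) :=
    (contMDiffAt_extChartAt.comp (P a b) hc).contDiffAt
  have hev : ∀ᶠ p in 𝓝 (P a b), c p ∈ (chartAt X.H (c (P a b))).source ∧
      MDifferentiableAt 𝓘(ℝ, ℝ × ℝ) X.I c p ∧ DifferentiableAt ℝ F p := by
    have e1 := hc.continuousAt.preimage_mem_nhds
      ((chartAt X.H (c (P a b))).open_source.mem_nhds (mem_chart_source _ _))
    have e2 := (contMDiffAt_iff_contMDiffAt_nhds (n := 1) (by simp)).1 (hc.of_le (m := 1) (by norm_cast))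
    have e3 := ((hFs.of_le (m := 1) (by norm_cast)).eventually (by simp))
    filter_upwards [e1, e2, e3] with p h1 h2 h3
    exact ⟨h1, h2.mdifferentiableAt (by simp), h3.differentiableAt (by simp)⟩
  have hev' : ∀ᶠ x in 𝓝 a, c (P x b) ∈ (chartAt X.H (c (P a b))).source ∧
      MDifferentiableAt 𝓘(ℝ, ℝ × ℝ) X.I c (P x b) ∧ DifferentiableAt ℝ F (P x b) :=
    (hu a b).continuousAt.eventually hev
  have hmd : ∀ x, MDifferentiableAt 𝓘(ℝ, ℝ × ℝ) X.I c (P x b) →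
      MDifferentiableAt 𝓘(ℝ, ℝ) X.I (fun b => c (P x b)) b := fun x hx =>
    hx.comp b (hv x b).differentiableAt.mdifferentiableAt
  have hder : ∀ x, DifferentiableAt ℝ F (P x b) →
      HasDerivAt (fun b => F (P x b)) (fderiv ℝ F (P x b) v) b := fun x hx =>
    hx.hasFDerivAt.comp_hasDerivAt b (hv x b)
  set Γ : ℝ → X.T.M := fun a => tangent (fun b => c (P a b)) b with hΓ
  have hpt := hev'.self_of_nhds
  have hΓa : Γ a = ⟨c (P a b), fderiv ℝ F (P a b) v⟩ :=
    tangent_eq _ _ _ (hmd a hpt.2.1).continuousAt (hder a hpt.2.2)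
  have hchart : ∀ᶠ x in 𝓝 a, extChartAt X.T.I (Γ a) (Γ x) = (F (P x b), fderiv ℝ F (P x b) v) := by
    filter_upwards [hev'] with x hx
    rw [extChartAt_tangent (Γ a) _ _ hx.1 (hmd x hx.2.1)]
    have := (hder x hx.2.2).deriv
    exact congrArg (Prod.mk (F (P x b))) this
  have hD : HasDerivAt (fun x => extChartAt X.T.I (Γ a) (Γ x))
      (fderiv ℝ F (P a b) u, fderiv ℝ (fderiv ℝ F) (P a b) u v) a := by
    refine HasDerivAt.congr_of_eventuallyEq ?_ hchart
    have h1 : HasDerivAt (fun x => F (P x b)) (fderiv ℝ F (P a b) u) a :=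
      HasFDerivAt.comp_hasDerivAt (f := fun x => P x b) a hpt.2.2.hasFDerivAt (hu a b)
    have h2 : DifferentiableAt ℝ (fderiv ℝ F) (P a b) :=
      (hFs.fderiv_right (m := 1) (by norm_cast)).differentiableAt (by simp)
    have h3 : HasDerivAt (fun x => fderiv ℝ F (P x b)) (fderiv ℝ (fderiv ℝ F) (P a b) u) a :=
      HasFDerivAt.comp_hasDerivAt (f := fun x => P x b) a h2.hasFDerivAt (hu a b)
    have h4 := h3.clm_apply (hasDerivAt_const a v)
    rw [map_zero, add_zero] at h4
    exact h1.prodMk h4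
  have := tangent_eq (X := X.T) Γ a _ (continuousAt_of_chart Γ a
    (hpt.2.1.continuousAt.comp (f := fun a => P a b) (hu a b).continuousAt) hD.continuousAt) hD
  rw [this, hΓa]

/-- The defining property of the canonical flip: `∂ₜ ∂ₛ c = canonicalFlip ∘ ∂ₛ ∂ₜ c` for all smooth maps
`c(t, s)` into `X`, on any domain. -/
theorem canonicalFlip_spec {X : Mfd.{u}} (c : ℝ × ℝ → X.M) (t s : ℝ)
    (hc : ContMDiffAt 𝓘(ℝ, ℝ × ℝ) X.I ∞ c (t, s)) :
    tangent (X := X.T) (fun t => tangent (fun s => c (t, s)) s) t =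
      canonicalFlip (tangent (X := X.T) (fun s => tangent (fun t => c (t, s)) t) s) := by
  have h1 := tangent_tangent c (fun t s => (t, s)) (1, 0) (0, 1)
    (fun a b => (hasDerivAt_id a).prodMk (hasDerivAt_const a b))
    (fun a b => (hasDerivAt_const b a).prodMk (hasDerivAt_id b)) t s hc
  have h2 := tangent_tangent c (fun s t => (t, s)) (0, 1) (1, 0)
    (fun a b => (hasDerivAt_const a b).prodMk (hasDerivAt_id a))
    (fun a b => (hasDerivAt_id b).prodMk (hasDerivAt_const b a)) s t hc
  have hFs : ContDiffAt ℝ ∞ (extChartAt X.I (c (t, s)) ∘ c) (t, s) :=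
    (contMDiffAt_extChartAt.comp (t, s) hc).contDiffAt
  have hsymm := hFs.isSymmSndFDerivAt (by simp; norm_cast)
  rw [h1, h2]
  simp only [canonicalFlip]
  rw [hsymm.eq]

end FlipCharacterization

section Iterated

variable (X : Mfd.{u})

/-- The projection `π_r : T^{r+1} X → T^r X`. -/
def proj (r : ℕ) : (X.iter (r + 1)).M → (X.iter r).M := fun ξ => ξ.proj

/-- The projection `T^r X → X`. -/
def projBase : (r : ℕ) → (X.iter r).M → X.M
  | 0 => id
  | r + 1 => projBase r ∘ proj X r

/-- The canonical involution `κ_r` of `T^r X` for `r ≥ 1`: `κ_1 = id`, and for `r ≥ 2` it is the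
canonical flip of `TTY` with `Y = T^{r-2} X`. (The value for `r = 0` is never used.) -/
def kappa : (r : ℕ) → (X.iter r).M → (X.iter r).M
  | 0 => id
  | 1 => id
  | r + 2 => canonicalFlip (X := X.iter r)

/-- The slashed bundle `T^r X ∖ 0`: all of `X` for `r = 0`, and for `r ≥ 1` the set of all `ξ`
for which `D(T^{r-1} X → X)(ξ)` is a nonzero vector in `TX`. (For `r = 1` this is the set of
nonzero vectors, since then the map `T^{r-1} X → X` is the identity.) -/
def slashed : (r : ℕ) → Set (X.iter r).M
  | 0 => Set.univ
  | r + 1 => {ξ | (D (X := X.iter r) (Y := X) (projBase X r) ξ).snd ≠ 0}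

/-- The Liouville vector field `E_r : T^r X → T^{r+1} X` for `r = k + 1`. -/
def liouvilleField (k : ℕ) : (X.iter (k + 1)).M → (X.iter (k + 2)).M :=
  liouville (X := X.iter k)

/-- `S` is a spray on `T^r X`: a smooth vector field on `T^{r+1} X ∖ 0` with `Dπ_r ∘ S = id` and
`[E_{r+1}, S] = S`. The values of `S` outside of `T^{r+1} X ∖ 0` are irrelevant. -/
structure IsSpray (r : ℕ) (S : (X.iter (r + 1)).M → (X.iter (r + 2)).M) : Prop where
  smooth : ContMDiffOn (X.iter (r + 1)).I (X.iter (r + 2)).I ∞ S (slashed X (r + 1))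
  isSection : ∀ ξ ∈ slashed X (r + 1), proj X (r + 1) (S ξ) = ξ
  secondOrder : ∀ ξ ∈ slashed X (r + 1), D (proj X r) (S ξ) = ξ
  homogeneous : ∀ ξ ∈ slashed X (r + 1),
    VectorField.mlieBracket (X.iter (r + 1)).I
      (fun η => vecAt η (liouvilleField X r η)) (fun η => vecAt η (S η)) ξ = vecAt ξ (S ξ)

/-- `γ : I → T^r X` is a geodesic of `S`, where `I` is an open interval: `γ` is smooth and regular
and satisfies `γ'' = S ∘ γ'` on `I`. A curve on `I` is given by a function on `ℝ` whose values
outside of `I` are irrelevant. -/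
structure IsGeodesic (r : ℕ) (S : (X.iter (r + 1)).M → (X.iter (r + 2)).M) (I : Set ℝ)
    (γ : ℝ → (X.iter r).M) : Prop where
  isOpen : IsOpen I
  ordConnected : I.OrdConnected
  smooth : ContMDiffOn 𝓘(ℝ, ℝ) (X.iter r).I ∞ γ I
  regular : ∀ t ∈ I, tangent γ t ∈ slashed X (r + 1)
  equation : ∀ t ∈ I, tangent (X := X.iter (r + 1)) (tangent γ) t = S (tangent γ t)

/-- The complete lift `S^c = Dκ_{r+2} ∘ κ_{r+3} ∘ DS ∘ κ_{r+2}` of a spray `S` on `T^r X`. -/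
def completeLift (r : ℕ) (S : (X.iter (r + 1)).M → (X.iter (r + 2)).M) :
    (X.iter (r + 2)).M → (X.iter (r + 3)).M :=
  D (kappa X (r + 2)) ∘ kappa X (r + 3) ∘
    D (X := X.iter (r + 1)) (Y := X.iter (r + 2)) S ∘ kappa X (r + 2)

/-- The iterated complete lifts `S^0 = S`, `S^{r+1} = (S^r)^c`; here `S^r` is a spray on
`T^r X`. -/
def iterLift (S : (X.iter 1).M → (X.iter 2).M) : (r : ℕ) → (X.iter (r + 1)).M → (X.iter (r + 2)).M
  | 0 => S
  | r + 1 => completeLift X r (iterLift S r)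

end Iterated

end IteratedTangent

end

open IteratedTangent

/-! The complete lift is the linearisation of the geodesic equation: if every curve `c(·, s)` solves
`γ'' = S ∘ γ'`, then the variation field `J(t) = ∂ₛ c(t, 0)` solves the equation of `S^c`. To see
this, differentiate `∂ₜ∂ₜ c = S(∂ₜ c)` in `s` and use the flips `κ` and `Dκ` to move `∂ₛ` to the
innermost place (`IsGeo.of_variation`). Three claims are instances of this: `j'` comes from `j(t +
s)`, `t j'(t)` from `j((1 + s) t)`, and `E_r ∘ j` from `(1 + s) j(t)`.

These variations do consist of geodesics. For the first two this is affine reparametrization, which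
rests on the positive homogeneity `S(Cξ) = C · Dm_C(S ξ)`, where `m_C` is multiplication by `C` in
the fibres. For the base spray, homogeneity follows from `[E, S] = S`: in a chart this is Euler's
identity of degree two for the fibre part of `S`, integrated along rays
(`isHomogeneousField_of_bracket`). It passes to complete lifts (`IsHomogeneousField.lift_smul`), so
the bracket is needed on `M` only. The third variation uses fibrewise linearity.

Since `κ` and `Dκ` are involutions, `J'' = S^c(J')` is equivalent to `κ ∂ₜ(κ J') = DS(κ J')`
(`lift_equation_iff`). Both sides are linear in `J` over a fixed projected curve, which gives linear
combinations; taking base points on both sides gives the geodesic equation of `π ∘ J`.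

Invariance under `κ` for `r ≥ 2` says that `S^cc` commutes with the flip
(`IsHomogeneousField.lift_lift_D_flip`). It follows from the braid relation `Dκ κ Dκ = κ Dκ κ` on
`TTTX` and the naturality of `κ`. Finally `Dπ = π ∘ κ`, so the claim on `Dπ` combines those on `κ`
and `π`.

Everything is proved for a field `S` on an open conic set `U ⊆ TX` over an arbitrary manifold `X`,
and then applied to `X = T^r M`. -/

noncomputable section

namespace IteratedTangent

open Filter Topology

universe u

/-! ### Directional derivatives in tangent charts -/

section Calculus

variable {X Y Z : Mfd.{u}} {P : Type*} [NormedAddCommGroup P] [NormedSpace ℝ P]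

/-- The directional derivative of `c` at `p` in direction `v`, as a point of `TX`. -/
def dir (c : P → X.M) (v p : P) : X.T.M := ⟨c p, mfderiv 𝓘(ℝ, P) X.I c p v⟩

theorem tangent_eq_dir (γ : ℝ → X.M) : tangent γ = dir γ 1 := rfl

theorem dir_proj (c : P → X.M) (v p : P) : (dir c v p).proj = c p := rfl

theorem extChartAt_totalSpace (q η : X.T.M) (h : η.proj ∈ (chartAt X.H q.proj).source) :
    extChartAt X.T.I q η =
      (extChartAt X.I q.proj η.proj, mfderiv X.I 𝓘(ℝ, X.E) (extChartAt X.I q.proj) η.proj η.snd) := by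
  have h1 : extChartAt X.T.I q η = (extChartAt X.I q.proj η.proj,
     (trivializationAt X.E (TangentSpace X.I) q.proj).continuousLinearMapAt ℝ η.proj η.snd) := by
    rw [TangentBundle.continuousLinearMapAt_trivializationAt_eq_core h]
    rfl
  rw [h1, TangentBundle.continuousLinearMapAt_trivializationAt h]
  rfl

theorem mem_chart_source_T (q η : X.T.M) :
    η ∈ (extChartAt X.T.I q).source ↔ η.proj ∈ (extChartAt X.I q.proj).source := by
  rw [extChartAt_source, extChartAt_source]
  exact TangentBundle.mem_chart_source_iff _ _

/-- A chart of `TX` is induced by the preferred chart of `X` at the base point of its centre, so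
moving the centre within a fibre changes nothing. This is what allows one chart to serve several
vectors over the same point. -/
theorem extChartAt_T_congr {q q' : X.T.M} (h : q.proj = q'.proj) :
    extChartAt X.T.I q = extChartAt X.T.I q' := by
  rw [FiberBundle.extChartAt, FiberBundle.extChartAt, h]

theorem extChartAt_self_T (x : X.M) (v w : TangentSpace X.I x) :
    extChartAt X.T.I (⟨x, w⟩ : X.T.M) (⟨x, v⟩ : X.T.M) = (extChartAt X.I x x, v) := by
  have h : (trivializationAt X.E (TangentSpace X.I) x).continuousLinearMapAt ℝ x v = v := by
    rw [TangentBundle.continuousLinearMapAt_trivializationAt_eq_core (mem_chart_source _ _)]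
    exact (tangentBundleCore X.I X.M).coordChange_self _ _ (mem_chart_source _ _) _
  rw [TangentBundle.continuousLinearMapAt_trivializationAt (mem_chart_source _ _)] at h
  exact (extChartAt_totalSpace (⟨x, w⟩ : X.T.M) ⟨x, v⟩ (mem_chart_source _ _)).trans
    (congrArg (Prod.mk _) h)

theorem mdifferentiableAt_of_contMDiffAt {c : P → X.M} {p : P}
    (hc : ContMDiffAt 𝓘(ℝ, P) X.I ∞ c p) : MDifferentiableAt 𝓘(ℝ, P) X.I c p :=
  hc.mdifferentiableAt (by simp)

theorem extChartAt_dir (q : X.T.M) (c : P → X.M) (v p : P)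
    (hs : c p ∈ (extChartAt X.I q.proj).source) (hc : MDifferentiableAt 𝓘(ℝ, P) X.I c p) :
    extChartAt X.T.I q (dir c v p) =
      (extChartAt X.I q.proj (c p), fderiv ℝ (extChartAt X.I q.proj ∘ c) p v) := by
  rw [extChartAt_source] at hs
  rw [extChartAt_totalSpace _ _ hs]
  have h2 : MDifferentiableAt X.I 𝓘(ℝ, X.E) (extChartAt X.I q.proj) (c p) :=
    mdifferentiableAt_extChartAt hs
  have h3 := mfderiv_comp p h2 hc
  rw [mfderiv_eq_fderiv] at h3
  rw [h3]
  rfl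

theorem dir_congr {c c' : P → X.M} {p : P} (h : c =ᶠ[𝓝 p] c') (v : P) :
    dir c v =ᶠ[𝓝 p] dir c' v := by
  filter_upwards [h.eventuallyEq_nhds] with a ha
  unfold dir
  rw [ha.mfderiv_eq]
  congr 1
  exact ha.self_of_nhds

theorem D_dir {f : X.M → Y.M} {c : P → X.M} {p : P} (v : P)
    (hf : MDifferentiableAt X.I Y.I f (c p)) (hc : MDifferentiableAt 𝓘(ℝ, P) X.I c p) :
    D f (dir c v p) = dir (f ∘ c) v p := by
  unfold dir D tangentMap
  rw [mfderiv_comp p hf hc]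
  rfl

theorem D_comp_apply {f : X.M → Y.M} {g : Y.M → Z.M} (ξ : X.T.M)
    (hg : MDifferentiableAt Y.I Z.I g (f ξ.proj)) (hf : MDifferentiableAt X.I Y.I f ξ.proj) :
    D (g ∘ f) ξ = D g (D f ξ) :=
  tangentMap_comp_at ξ hg hf

theorem D_congr {f g : X.M → Y.M} {ξ : X.T.M} (h : f =ᶠ[𝓝 ξ.proj] g) :
    D f ξ = D g ξ := by
  unfold D tangentMap
  rw [h.mfderiv_eq, h.self_of_nhds]

theorem dir_comp_line {Q : Type*} [NormedAddCommGroup Q] [NormedSpace ℝ Q] {c : P → X.M}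
    {L : Q → P} {L' : Q →L[ℝ] P} {q : Q} (v : Q)
    (hc : MDifferentiableAt 𝓘(ℝ, P) X.I c (L q)) (hL : HasFDerivAt L L' q) :
    dir (c ∘ L) v q = dir c (L' v) (L q) := by
  unfold dir
  rw [mfderiv_comp q hc hL.differentiableAt.mdifferentiableAt, mfderiv_eq_fderiv, hL.fderiv]
  rfl

/-- A map into `TX` is smooth if its base point and its fibre coordinate are. -/
theorem contMDiffAt_T_iff {f : P → X.T.M} {p : P} :
    ContMDiffAt 𝓘(ℝ, P) X.T.I ∞ f p ↔ ContMDiffAt 𝓘(ℝ, P) X.I ∞ (fun a => (f a).proj) p ∧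
      ContDiffAt ℝ ∞ (fun a => (extChartAt X.T.I (f p) (f a)).2) p := by
  rw [← contMDiffAt_iff_contDiffAt]
  exact Bundle.contMDiffAt_totalSpace

theorem eventually_chart {c : P → X.M} {p : P} (hc : ContMDiffAt 𝓘(ℝ, P) X.I ∞ c p) (x : X.M)
    (hx : c p ∈ (extChartAt X.I x).source) :
    ∀ᶠ a in 𝓝 p, c a ∈ (extChartAt X.I x).source ∧ MDifferentiableAt 𝓘(ℝ, P) X.I c a := by
  have e1 := hc.continuousAt.preimage_mem_nhds ((isOpen_extChartAt_source x).mem_nhds hx)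
  have e2 := (contMDiffAt_iff_contMDiffAt_nhds (n := 1) (by simp)).1
    (hc.of_le (m := 1) (by norm_cast))
  filter_upwards [e1, e2] with _ h1 h2
  exact ⟨h1, h2.mdifferentiableAt (by simp)⟩

theorem contDiffAt_chart {c : P → X.M} {p : P} (hc : ContMDiffAt 𝓘(ℝ, P) X.I ∞ c p) (x : X.M)
    (hx : c p ∈ (extChartAt X.I x).source) : ContDiffAt ℝ ∞ (extChartAt X.I x ∘ c) p := by
  rw [extChartAt_source] at hx
  exact ((contMDiffAt_extChartAt' hx).comp p hc).contDiffAt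

theorem contMDiffAt_dir {c : P → X.M} {p : P} (hc : ContMDiffAt 𝓘(ℝ, P) X.I ∞ c p) (v : P) :
    ContMDiffAt 𝓘(ℝ, P) X.T.I ∞ (dir c v) p := by
  refine contMDiffAt_T_iff.2 ⟨hc, ?_⟩
  have hs := mem_extChartAt_source (I := X.I) (c p)
  have h := (contDiffAt_chart hc (c p) hs).fderiv_right (m := ∞) (by norm_cast)
  refine (h.clm_apply (contDiffAt_const (c := v))).congr_of_eventuallyEq ?_
  filter_upwards [eventually_chart hc (c p) hs] with a ha
  exact congrArg Prod.snd (extChartAt_dir (dir c v p) c v a ha.1 ha.2)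

theorem contMDiffOn_dir {c : P → X.M} {s : Set P} (hs : IsOpen s)
    (hc : ContMDiffOn 𝓘(ℝ, P) X.I ∞ c s) (v : P) :
    ContMDiffOn 𝓘(ℝ, P) X.T.I ∞ (dir c v) s := fun _ hp =>
  (contMDiffAt_dir (hc.contMDiffAt (hs.mem_nhds hp)) v).contMDiffWithinAt

/-- Chart expression of a second derivative. -/
theorem extChartAt_dir_dir (q : X.T.T.M) (c : P → X.M) (v w p : P)
    (hs : c p ∈ (extChartAt X.I q.proj.proj).source) (hc : ContMDiffAt 𝓘(ℝ, P) X.I ∞ c p) :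
    extChartAt X.T.T.I q (dir (dir c v) w p) =
      ((extChartAt X.I q.proj.proj (c p), fderiv ℝ (extChartAt X.I q.proj.proj ∘ c) p v),
       (fderiv ℝ (extChartAt X.I q.proj.proj ∘ c) p w,
        fderiv ℝ (fderiv ℝ (extChartAt X.I q.proj.proj ∘ c)) p w v)) := by
  have hd := contMDiffAt_dir hc v
  have hF := contDiffAt_chart hc _ hs
  have e := eventually_chart hc _ hs
  have hev : extChartAt X.T.I q.proj ∘ dir c v =ᶠ[𝓝 p]
      fun a => ((extChartAt X.I q.proj.proj ∘ c) a,
        fderiv ℝ (extChartAt X.I q.proj.proj ∘ c) a v) := by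
    filter_upwards [e] with a ha
    exact extChartAt_dir q.proj c v a ha.1 ha.2
  rw [extChartAt_dir (X := X.T) q (dir c v) w p ((mem_chart_source_T _ _).2 hs)
    (mdifferentiableAt_of_contMDiffAt hd), hev.fderiv_eq]
  have h1 : DifferentiableAt ℝ (fderiv ℝ (extChartAt X.I q.proj.proj ∘ c)) p :=
    (hF.fderiv_right (m := ∞) (by norm_cast)).differentiableAt (by simp)
  have h2 := (hF.differentiableAt (by simp)).hasFDerivAt.prodMk
    (h1.hasFDerivAt.clm_apply (hasFDerivAt_const v p))
  rw [h2.fderiv]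
  have h3 := hev.self_of_nhds
  refine Prod.ext h3 ?_
  simp

theorem extChartAt_injOn_T (q : X.T.M) {η ζ : X.T.M} (hη : η.proj ∈ (extChartAt X.I q.proj).source)
    (hζ : ζ.proj ∈ (extChartAt X.I q.proj).source)
    (h : extChartAt X.T.I q η = extChartAt X.T.I q ζ) : η = ζ :=
  (extChartAt X.T.I q).injOn ((mem_chart_source_T _ _).2 hη) ((mem_chart_source_T _ _).2 hζ) h

theorem symm_line {x : X.M} {p : P} (f : P → X.E) (hf : ContDiffAt ℝ ∞ f p)
    (hp : f p ∈ (extChartAt X.I x).target) :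
    ContMDiffAt 𝓘(ℝ, P) X.I ∞ ((extChartAt X.I x).symm ∘ f) p ∧
      extChartAt X.I x ∘ ((extChartAt X.I x).symm ∘ f) =ᶠ[𝓝 p] f := by
  have ht : (extChartAt X.I x).target ∈ 𝓝 (f p) := (isOpen_extChartAt_target x).mem_nhds hp
  constructor
  · exact ((contMDiffOn_extChartAt_symm x).contMDiffAt ht).comp p hf.contMDiffAt
  · filter_upwards [hf.continuousAt.preimage_mem_nhds ht] with a ha
    exact (extChartAt X.I x).right_inv ha

/-- Every point of `TTX` is a second derivative. -/
theorem exists_dir_dir (ξ : X.T.T.M) : ∃ c : ℝ × ℝ → X.M,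
    ContMDiffAt 𝓘(ℝ, ℝ × ℝ) X.I ∞ c (0, 0) ∧ c (0, 0) = ξ.proj.proj ∧
      ξ = dir (dir c (0, 1)) (1, 0) (0, 0) := by
  obtain ⟨⟨x, y⟩, X', Y'⟩ := ξ
  change X.E at y X' Y'
  -- A polynomial in `(t, s)` with prescribed 2-jet data at the origin: `∂ₛB = y`, `∂ₜB = X'` and
  -- mixed derivative `∂ₜ∂ₛB = Y'`.
  set B : ℝ × ℝ → X.E := fun p => extChartAt X.I x x + p.2 • y + p.1 • X' + (p.1 * p.2) • Y' with hB
  have hBs : ContDiff ℝ ∞ B := by fun_prop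
  have h0 : B (0, 0) = extChartAt X.I x x := by simp [hB]
  obtain ⟨h1, h2⟩ := symm_line (x := x) (p := (0, 0)) B hBs.contDiffAt
    (by rw [h0]; exact mem_extChartAt_target x)
  have hc0 : ((extChartAt X.I x).symm ∘ B) (0, 0) = x := by
    rw [Function.comp_apply, h0, extChartAt_to_inv]
  refine ⟨_, h1, hc0, ?_⟩
  refine extChartAt_injOn_T (X := X.T) ⟨⟨x, y⟩, (X', Y')⟩ (mem_extChartAt_source _) ?_ ?_
  · refine (mem_chart_source_T _ _).2 ?_
    simp only [dir_proj, hc0]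
    exact mem_extChartAt_source _
  · rw [extChartAt_dir_dir _ _ _ _ _ (by rw [hc0]; exact mem_extChartAt_source _) h1]
    have hd : ∀ p : ℝ × ℝ, HasFDerivAt B ((ContinuousLinearMap.snd ℝ ℝ ℝ).smulRight y +
        (ContinuousLinearMap.fst ℝ ℝ ℝ).smulRight X' +
        (p.1 • ContinuousLinearMap.snd ℝ ℝ ℝ + p.2 • ContinuousLinearMap.fst ℝ ℝ ℝ).smulRight Y')
        p := by
      intro p
      have := (((hasFDerivAt_snd (𝕜 := ℝ) (p := p)).smul_const y).const_add
        (extChartAt X.I x x)).add ((hasFDerivAt_fst (𝕜 := ℝ) (p := p)).smul_const X')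
      exact this.add (((hasFDerivAt_fst (𝕜 := ℝ) (p := p)).mul hasFDerivAt_snd).smul_const Y')
    have hd' : fderiv ℝ B = _ := funext fun p => (hd p).fderiv
    have hdd : HasFDerivAt (fun p => fderiv ℝ B p (0, 1))
        ((ContinuousLinearMap.fst ℝ ℝ ℝ).smulRight Y') (0, 0) := by
      have : (fun p => fderiv ℝ B p (0, 1)) = fun p : ℝ × ℝ => y + p.1 • Y' := by
        rw [hd']; ext p; simp
      rw [this]
      exact (hasFDerivAt_fst.smul_const Y').const_add y
    have hdd2 : fderiv ℝ (fderiv ℝ B) (0, 0) (1, 0) (0, 1) = Y' := by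
      have h4 : DifferentiableAt ℝ (fderiv ℝ B) (0, 0) :=
        ((hBs.fderiv_right (m := ∞) (by norm_cast)).differentiable (by simp)) _
      have h5 := (h4.hasFDerivAt.clm_apply (hasFDerivAt_const ((0, 1) : ℝ × ℝ) (0, 0))).unique hdd
      have := congrArg (fun L => L (1, 0)) h5
      simpa using this
    rw [h2.fderiv.fderiv_eq, h2.fderiv_eq, hdd2, (hd _).fderiv, hc0]
    have e1 := extChartAt_self_T (X := X.T) ⟨x, y⟩ (X', Y') (X', Y')
    rw [e1, extChartAt_self_T x y y]
    simp
    rfl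

end Calculus

/-! ### Maps that are linear in preferred charts -/

section ChartLinear

variable {X Y Z : Mfd.{u}} {P : Type*} [NormedAddCommGroup P] [NormedSpace ℝ P]

/-- `f` is given by the linear map `L` in the preferred charts at `x` and `f x`. -/
def IsChartLinear (f : X.M → Y.M) (x : X.M) (L : X.E →L[ℝ] Y.E) : Prop :=
  ∀ ξ ∈ (extChartAt X.I x).source, f ξ ∈ (extChartAt Y.I (f x)).source ∧
    extChartAt Y.I (f x) (f ξ) = L (extChartAt X.I x ξ)

theorem IsChartLinear.contMDiffAt {f : X.M → Y.M} {x : X.M} {L : X.E →L[ℝ] Y.E}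
    (h : IsChartLinear f x L) : ContMDiffAt X.I Y.I ∞ f x := by
  have hx := mem_extChartAt_source (I := X.I) x
  have h1 : ContMDiffAt X.I 𝓘(ℝ, Y.E) ∞ (fun ξ => L (extChartAt X.I x ξ)) x :=
    ContMDiffAt.comp x (g := L) (f := extChartAt X.I x) (I' := 𝓘(ℝ, X.E))
      L.contDiff.contMDiff.contMDiffAt contMDiffAt_extChartAt
  have h2 : ContMDiffAt X.I Y.I ∞
      (fun ξ => (extChartAt Y.I (f x)).symm (L (extChartAt X.I x ξ))) x := by
    refine ContMDiffAt.comp x (g := (extChartAt Y.I (f x)).symm) (I' := 𝓘(ℝ, Y.E)) ?_ h1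
    refine (contMDiffOn_extChartAt_symm (f x)).contMDiffAt ?_
    rw [← (h x hx).2]
    exact extChartAt_target_mem_nhds (f x)
  refine h2.congr_of_eventuallyEq ?_
  filter_upwards [extChartAt_source_mem_nhds (I := X.I) x] with ξ hξ
  rw [← (h ξ hξ).2]
  exact ((extChartAt Y.I (f x)).left_inv (h ξ hξ).1).symm

/-- The tangent space at a point is the model space read through the preferred chart there, so the
derivative is that of the chart expression, namely `L` itself. Identities between tangent maps of
flips, projections and scalings thereby become coordinate permutations and scalings. -/
theorem IsChartLinear.D_eq {f : X.M → Y.M} {x : X.M} {L : X.E →L[ℝ] Y.E}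
    (h : IsChartLinear f x L) (v : TangentSpace X.I x) :
    D f (⟨x, v⟩ : X.T.M) = ⟨f x, L v⟩ := by
  have : HasMFDerivAt X.I Y.I f x L := by
    refine ⟨h.contMDiffAt.continuousAt, ?_⟩
    have h1 : HasFDerivWithinAt L L (Set.range X.I) (extChartAt X.I x x) :=
      L.hasFDerivAt.hasFDerivWithinAt
    have key : ∀ z ∈ (extChartAt X.I x).target, writtenInExtChartAt X.I Y.I x f z = L z := by
      intro z hz
      have := (h _ ((extChartAt X.I x).map_target hz)).2
      rw [(extChartAt X.I x).right_inv hz] at this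
      exact this
    refine h1.congr_of_eventuallyEq ?_ (key _ (mem_extChartAt_target x))
    filter_upwards [extChartAt_target_mem_nhdsWithin (I := X.I) x] with z hz
    exact key z hz
  unfold D tangentMap
  rw [this.mfderiv]
  rfl

end ChartLinear

/-! ### The canonical flip: smoothness, naturality, braid relation -/

section Flip

variable {X Y Z : Mfd.{u}} {P : Type*} [NormedAddCommGroup P] [NormedSpace ℝ P]

theorem flip_flip (ξ : X.T.T.M) : canonicalFlip (canonicalFlip ξ) = ξ := rfl

theorem dir_eq (c : P → X.M) (v p : P) (hc : ContMDiffAt 𝓘(ℝ, P) X.I ∞ c p) :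
    dir c v p = ⟨c p, fderiv ℝ (extChartAt X.I (c p) ∘ c) p v⟩ := by
  have hs := mem_extChartAt_source (I := X.I) (c p)
  refine extChartAt_injOn_T (dir c v p) hs hs ?_
  rw [extChartAt_dir _ c v p hs (mdifferentiableAt_of_contMDiffAt hc)]
  exact (extChartAt_self_T (c p) _ _).symm

theorem dir_dir_eq (c : P → X.M) (v w p : P) (hc : ContMDiffAt 𝓘(ℝ, P) X.I ∞ c p) :
    dir (dir c v) w p = (⟨⟨c p, fderiv ℝ (extChartAt X.I (c p) ∘ c) p v⟩,
      (fderiv ℝ (extChartAt X.I (c p) ∘ c) p w,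
        fderiv ℝ (fderiv ℝ (extChartAt X.I (c p) ∘ c)) p w v)⟩ : X.T.T.M) := by
  have hs := mem_extChartAt_source (I := X.I) (c p)
  refine extChartAt_injOn_T (X := X.T) (dir (dir c v) w p) (mem_extChartAt_source _)
    ((mem_chart_source_T _ _).2 hs) ?_
  have h1 := extChartAt_dir_dir (dir (dir c v) w p) c v w p hs hc
  have h2 := extChartAt_self_T (c p) (fderiv ℝ (extChartAt X.I (c p) ∘ c) p v)
    (mfderiv 𝓘(ℝ, P) X.I c p v)
  have h3 := extChartAt_totalSpace (X := X.T) (dir (dir c v) w p)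
    (⟨⟨c p, fderiv ℝ (extChartAt X.I (c p) ∘ c) p v⟩,
      (fderiv ℝ (extChartAt X.I (c p) ∘ c) p w,
        fderiv ℝ (fderiv ℝ (extChartAt X.I (c p) ∘ c)) p w v)⟩ : X.T.T.M)
    (by rw [← extChartAt_source X.T.I]; exact (mem_chart_source_T _ _).2 hs)
  have h4 := extChartAt_self_T (X := X.T) ⟨c p, fderiv ℝ (extChartAt X.I (c p) ∘ c) p v⟩
    (fderiv ℝ (extChartAt X.I (c p) ∘ c) p w,
        fderiv ℝ (fderiv ℝ (extChartAt X.I (c p) ∘ c)) p w v) 0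
  -- The two centres lie over points of `TX` that are equal by `dir_eq`, though not syntactically,
  -- so the charts have to be exchanged.
  have h5 : extChartAt X.T.T.I (dir (dir c v) w p) = extChartAt X.T.T.I
      (⟨⟨c p, fderiv ℝ (extChartAt X.I (c p) ∘ c) p v⟩, 0⟩ : X.T.T.M) := by
    refine extChartAt_T_congr (X := X.T) ?_
    have := dir_eq c v p hc
    exact this
  rw [h1, h5]
  refine Eq.trans ?_ h4.symm
  exact Prod.ext ((extChartAt_self_T (c p) _ _).symm) rfl

/-- Symmetry of second derivatives. As every point of `TTX` is a second derivative, this identity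
determines the flip. -/
theorem flip_dir_dir (c : P → X.M) (v w p : P) (hc : ContMDiffAt 𝓘(ℝ, P) X.I ∞ c p) :
    canonicalFlip (dir (dir c v) w p) = dir (dir c w) v p := by
  have hsymm := (contDiffAt_chart hc (c p) (mem_extChartAt_source _)).isSymmSndFDerivAt
    (by simp; norm_cast)
  rw [dir_dir_eq _ _ _ _ hc, dir_dir_eq _ _ _ _ hc, hsymm.eq w v]
  rfl

/-- The coordinate expression of the canonical flip. -/
def flipL (E : Type*) [NormedAddCommGroup E] [NormedSpace ℝ E] :
    ((E × E) × (E × E)) →L[ℝ] ((E × E) × (E × E)) :=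
  open ContinuousLinearMap in
  (((fst ℝ E E).comp (fst ℝ (E × E) (E × E))).prod ((fst ℝ E E).comp (snd ℝ (E × E) (E × E)))).prod
    (((snd ℝ E E).comp (fst ℝ (E × E) (E × E))).prod ((snd ℝ E E).comp (snd ℝ (E × E) (E × E))))

/-- The flip is defined in the coordinates of the preferred chart at each point; symmetry of second
derivatives shows that it has the same form in every induced chart. Two centres are allowed because
flipping the centre preserves only its base point in `X`. -/
theorem extChartAt_flip (q q' ξ : X.T.T.M) (h : ξ.proj.proj ∈ (extChartAt X.I q.proj.proj).source)
    (hq : q'.proj.proj = q.proj.proj) :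
    extChartAt X.T.T.I q' (canonicalFlip ξ) = flipL X.E (extChartAt X.T.T.I q ξ) := by
  obtain ⟨c, hc, h0, rfl⟩ := exists_dir_dir ξ
  rw [dir_proj, dir_proj] at h
  have hsymm := (contDiffAt_chart hc _ h).isSymmSndFDerivAt (by simp; norm_cast)
  rw [flip_dir_dir _ _ _ _ hc, extChartAt_dir_dir q' _ _ _ _ (by rw [hq]; exact h) hc,
    extChartAt_dir_dir q _ _ _ _ h hc, hq, hsymm.eq (0, 1) (1, 0)]
  rfl

theorem isChartLinear_flip (q : X.T.T.M) :
    IsChartLinear (X := X.T.T) (Y := X.T.T) canonicalFlip q (flipL X.E) := by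
  intro ξ hξ
  have h : ξ.proj.proj ∈ (extChartAt X.I q.proj.proj).source :=
    (mem_chart_source_T _ _).1 ((mem_chart_source_T (X := X.T) _ _).1 hξ)
  exact ⟨(mem_chart_source_T (X := X.T) _ _).2 ((mem_chart_source_T _ _).2 h),
    extChartAt_flip q _ ξ h rfl⟩

theorem contMDiff_flip : ContMDiff X.T.T.I X.T.T.I ∞ (canonicalFlip (X := X)) :=
  fun q => (isChartLinear_flip q).contMDiffAt

theorem mdifferentiableAt_flip (q : X.T.T.M) :
    MDifferentiableAt X.T.T.I X.T.T.I (canonicalFlip (X := X)) q :=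
  contMDiff_flip.contMDiffAt.mdifferentiableAt (by simp)

theorem D_flip (ξ : X.T.T.T.M) : D (X := X.T.T) (Y := X.T.T) canonicalFlip ξ =
    (⟨canonicalFlip ξ.proj, flipL X.E ξ.snd⟩ : X.T.T.T.M) :=
  (isChartLinear_flip ξ.proj).D_eq ξ.snd

theorem D_flip_D_flip (ξ : X.T.T.T.M) : D (X := X.T.T) (Y := X.T.T) canonicalFlip
    (D (X := X.T.T) (Y := X.T.T) canonicalFlip ξ) = ξ := by
  rw [D_flip, D_flip]; rfl

/-- On the eight coordinates of `TTTX` the two flips act as adjacent transpositions of the three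
directions of differentiation, so this is the braid relation of the symmetric group on three
letters. -/
theorem flip_braid (ξ : X.T.T.T.M) :
    D (X := X.T.T) (Y := X.T.T) canonicalFlip (canonicalFlip (X := X.T)
      (D (X := X.T.T) (Y := X.T.T) canonicalFlip ξ)) =
    canonicalFlip (X := X.T) (D (X := X.T.T) (Y := X.T.T) canonicalFlip
      (canonicalFlip (X := X.T) ξ)) := by
  rw [D_flip, D_flip, D_flip]; rfl

theorem isChartLinear_proj (q : X.T.M) :
    IsChartLinear (X := X.T) (Y := X) (fun ξ => ξ.proj) q (ContinuousLinearMap.fst ℝ X.E X.E) := by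
  intro ξ hξ
  exact ⟨(mem_chart_source_T _ _).1 hξ, rfl⟩

theorem contMDiff_proj : ContMDiff X.T.I X.I ∞ (fun ξ : X.T.M => ξ.proj) :=
  fun q => (isChartLinear_proj q).contMDiffAt

theorem D_proj (ξ : X.T.T.M) : D (X := X.T) (Y := X) (fun ξ => ξ.proj) ξ = (canonicalFlip ξ).proj :=
  (isChartLinear_proj ξ.proj).D_eq ξ.snd

theorem extChartAt_smul (q ξ : X.T.M) (C : ℝ) (h : ξ.proj ∈ (extChartAt X.I q.proj).source) :
    extChartAt X.T.I q (fibreSMul C ξ) =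
      ((extChartAt X.T.I q ξ).1, C • (extChartAt X.T.I q ξ).2) := by
  rw [extChartAt_source] at h
  rw [extChartAt_totalSpace _ _ h, extChartAt_totalSpace q (fibreSMul C ξ) h]
  refine Prod.ext rfl ?_
  exact map_smul (mfderiv X.I 𝓘(ℝ, X.E) (extChartAt X.I q.proj) ξ.proj) C ξ.snd

theorem isChartLinear_smul (C : ℝ) (q : X.T.M) :
    IsChartLinear (X := X.T) (Y := X.T) (fibreSMul C) q
      ((ContinuousLinearMap.id ℝ X.E).prodMap (C • ContinuousLinearMap.id ℝ X.E)) := by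
  intro ξ hξ
  have h := (mem_chart_source_T _ _).1 hξ
  refine ⟨(mem_chart_source_T _ _).2 h, ?_⟩
  rw [extChartAt_T_congr (q := fibreSMul C q) (q' := q) rfl, extChartAt_smul q ξ C h]
  rfl

theorem contMDiff_smul (C : ℝ) : ContMDiff X.T.I X.T.I ∞ (fibreSMul (X := X) C) :=
  fun q => (isChartLinear_smul C q).contMDiffAt

theorem D_smul (C : ℝ) (ξ : X.T.T.M) : D (X := X.T) (Y := X.T) (fibreSMul C) ξ =
    (⟨fibreSMul C ξ.proj, ((ξ.snd : X.E × X.E).1, C • (ξ.snd : X.E × X.E).2)⟩ : X.T.T.M) :=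
  (isChartLinear_smul C ξ.proj).D_eq ξ.snd

theorem D_fibreSMul (f : X.M → Y.M) (C : ℝ) (ξ : X.T.M) :
    D f (fibreSMul C ξ) = fibreSMul C (D f ξ) := by
  unfold D tangentMap fibreSMul
  congr 1
  exact map_smul (mfderiv X.I Y.I f ξ.proj) C ξ.snd

theorem flip_smul (C : ℝ) (ξ : X.T.T.M) :
    canonicalFlip (fibreSMul (X := X.T) C ξ) =
      D (X := X.T) (Y := X.T) (fibreSMul C) (canonicalFlip ξ) := by
  rw [D_smul]; rfl

theorem flip_D_smul (C : ℝ) (ξ : X.T.T.M) :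
    canonicalFlip (D (X := X.T) (Y := X.T) (fibreSMul C) ξ) =
      fibreSMul (X := X.T) C (canonicalFlip ξ) := by
  rw [D_smul]; rfl

theorem contMDiffAt_D {f : X.M → Y.M} {U : Set X.M} (hU : IsOpen U)
    (hf : ContMDiffOn X.I Y.I ∞ f U) (ξ : X.T.M) (hξ : ξ.proj ∈ U) :
    ContMDiffAt X.T.I Y.T.I ∞ (D f) ξ := by
  have hV : IsOpen {ξ : X.T.M | ξ.proj ∈ U} :=
    hU.preimage contMDiff_proj.continuous
  have h := hf.contMDiffOn_tangentMapWithin (m := ∞) (by norm_cast) hU.uniqueMDiffOn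
  have h2 : ContMDiffAt X.T.I Y.T.I ∞ (tangentMapWithin X.I Y.I f U) ξ :=
    h.contMDiffAt (hV.mem_nhds hξ)
  refine h2.congr_of_eventuallyEq ?_
  filter_upwards [hV.mem_nhds hξ] with η hη
  exact (tangentMapWithin_eq_tangentMap (hU.uniqueMDiffOn _ hη)
    ((hf.contMDiffAt (hU.mem_nhds hη)).mdifferentiableAt (by simp))).symm

/-- Naturality of the canonical flip. -/
theorem flip_D_D {f : X.M → Y.M} {U : Set X.M} (hU : IsOpen U)
    (hf : ContMDiffOn X.I Y.I ∞ f U) (ξ : X.T.T.M) (hξ : ξ.proj.proj ∈ U) :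
    canonicalFlip (D (X := X.T) (Y := Y.T) (D f) ξ) =
      D (X := X.T) (Y := Y.T) (D f) (canonicalFlip ξ) := by
  obtain ⟨c, hc, h0, rfl⟩ := exists_dir_dir ξ
  rw [dir_proj, dir_proj] at hξ
  have hfc : ContMDiffAt X.I Y.I ∞ f (c (0, 0)) := hf.contMDiffAt (hU.mem_nhds hξ)
  -- `DDf` carries second derivatives of `c` to second derivatives of `f ∘ c`, so naturality reduces
  -- to symmetry for both maps.
  have key : ∀ v w : ℝ × ℝ, D (X := X.T) (Y := Y.T) (D f) (dir (dir c v) w (0, 0)) =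
      dir (dir (f ∘ c) v) w (0, 0) := by
    intro v w
    rw [D_dir w ((contMDiffAt_D hU hf _ (by exact hξ)).mdifferentiableAt (by simp))
      (mdifferentiableAt_of_contMDiffAt (contMDiffAt_dir hc v))]
    refine (dir_congr (X := Y.T) ?_ w).self_of_nhds
    filter_upwards [eventually_chart hc _ (mem_extChartAt_source _),
      hc.continuousAt.preimage_mem_nhds (hU.mem_nhds hξ)] with a ha hU'
    exact D_dir v ((hf.contMDiffAt (hU.mem_nhds hU')).mdifferentiableAt (by simp)) ha.2
  rw [key, flip_dir_dir _ _ _ _ hc, key, flip_dir_dir _ _ _ _ (hfc.comp _ hc)]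

end Flip

/-! ### Complete lifts, homogeneity, and the geodesic equation -/

section Lift

variable {X Y : Mfd.{u}}

/-- The complete lift of `S : TX → TTX`. -/
def lift (S : X.T.M → X.T.T.M) : X.T.T.M → X.T.T.T.M :=
  D (X := X.T.T) (Y := X.T.T) canonicalFlip ∘ canonicalFlip (X := X.T) ∘
    D (X := X.T) (Y := X.T.T) S ∘ canonicalFlip

/-- The domain of the complete lift of a map defined on `U`. -/
def liftSet (U : Set X.T.M) : Set X.T.T.M := {ξ | (canonicalFlip ξ).proj ∈ U}

/-- `S` is smooth and positively homogeneous on the conic open set `U`. -/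
structure IsHomogeneousField (U : Set X.T.M) (S : X.T.M → X.T.T.M) : Prop where
  isOpen : IsOpen U
  smooth : ContMDiffOn X.T.I X.T.T.I ∞ S U
  smul_mem : ∀ C : ℝ, 0 < C → ∀ ξ ∈ U, fibreSMul C ξ ∈ U
  map_smul : ∀ C : ℝ, 0 < C → ∀ ξ ∈ U,
    S (fibreSMul C ξ) = fibreSMul (X := X.T) C (D (X := X.T) (Y := X.T) (fibreSMul C) (S ξ))

variable {U : Set X.T.M} {S : X.T.M → X.T.T.M}

theorem isOpen_liftSet (hU : IsOpen U) : IsOpen (liftSet U) :=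
  hU.preimage (contMDiff_proj.continuous.comp contMDiff_flip.continuous)

theorem IsHomogeneousField.mdifferentiableAt (h : IsHomogeneousField U S) {ξ : X.T.M}
    (hξ : ξ ∈ U) : MDifferentiableAt X.T.I X.T.T.I S ξ :=
  (h.smooth.contMDiffAt (h.isOpen.mem_nhds hξ)).mdifferentiableAt (by simp)

theorem contMDiff_D {f : X.M → Y.M} (hf : ContMDiff X.I Y.I ∞ f) :
    ContMDiff X.T.I Y.T.I ∞ (D f) := fun ξ =>
  contMDiffAt_D isOpen_univ hf.contMDiffOn ξ trivial

theorem IsHomogeneousField.contMDiffAt_lift (h : IsHomogeneousField U S) {ξ : X.T.T.M}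
    (hξ : ξ ∈ liftSet U) : ContMDiffAt X.T.T.I X.T.T.T.I ∞ (lift S) ξ := by
  have h1 : ContMDiffAt X.T.T.I X.T.T.T.I ∞
      (D (X := X.T) (Y := X.T.T) S ∘ canonicalFlip) ξ :=
    (contMDiffAt_D (X := X.T) (Y := X.T.T) h.isOpen h.smooth (canonicalFlip ξ) hξ).comp ξ
      contMDiff_flip.contMDiffAt
  have h2 := (contMDiff_flip (X := X.T)).contMDiffAt.comp ξ h1
  exact (contMDiff_D (X := X.T.T) (Y := X.T.T) contMDiff_flip).contMDiffAt.comp ξ h2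

/-- Scaling the fibres of `TTX → TX` and the tangent map of scaling in `TX` are exchanged by the
flip. Pushing the scaling through the factors of `Dκ κ DS κ` and using the homogeneity of `S` at the
factor `DS` returns the same law one level up. -/
theorem IsHomogeneousField.lift_smul (h : IsHomogeneousField U S) {C : ℝ} (hC : 0 < C)
    {ξ : X.T.T.M} (hξ : ξ ∈ liftSet U) :
    lift S (fibreSMul (X := X.T) C ξ) = fibreSMul (X := X.T.T) C
      (D (X := X.T.T) (Y := X.T.T) (fibreSMul (X := X.T) C) (lift S ξ)) := by
  have hm : ContMDiff X.T.I X.T.I ∞ (fibreSMul (X := X) C) := contMDiff_smul C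
  have hDm : ContMDiff X.T.T.I X.T.T.I ∞ (D (X := X.T) (Y := X.T) (fibreSMul C)) := contMDiff_D hm
  have hm' : ContMDiff X.T.T.I X.T.T.I ∞ (fibreSMul (X := X.T) C) := contMDiff_smul C
  have hd : ∀ {A B : Mfd.{u}} {f : A.M → B.M} (_ : ContMDiff A.I B.I ∞ f) (a : A.M),
      MDifferentiableAt A.I B.I f a := fun hf a => hf.contMDiffAt.mdifferentiableAt (by simp)
  set η := canonicalFlip ξ with hη
  have hηU : η.proj ∈ U := hξ
  have hS := h.mdifferentiableAt hηU
  have e1 : D (X := X.T) (Y := X.T.T) S (D (X := X.T) (Y := X.T) (fibreSMul C) η) =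
      D (X := X.T.T) (Y := X.T.T) (fibreSMul (X := X.T) C)
        (D (X := X.T.T) (Y := X.T.T) (D (X := X.T) (Y := X.T) (fibreSMul C))
          (D (X := X.T) (Y := X.T.T) S η)) := by
    rw [← D_comp_apply (X := X.T) (Y := X.T) (Z := X.T.T) η
      (h.mdifferentiableAt (h.smul_mem C hC _ hηU)) (hd hm _)]
    have e : S ∘ fibreSMul C =ᶠ[𝓝 η.proj]
        fibreSMul (X := X.T) C ∘ (D (X := X.T) (Y := X.T) (fibreSMul C) ∘ S) := by
      filter_upwards [h.isOpen.mem_nhds hηU] with a ha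
      exact h.map_smul C hC a ha
    rw [D_congr (X := X.T) (Y := X.T.T) e,
      D_comp_apply (X := X.T) (Y := X.T.T) (Z := X.T.T) η (hd hm' _) ((hd hDm _).comp _ hS),
      D_comp_apply (X := X.T) (Y := X.T.T) (Z := X.T.T) η (hd hDm _) hS]
  have e2 : ∀ θ : X.T.T.T.M, D (X := X.T.T) (Y := X.T.T) canonicalFlip
      (D (X := X.T.T) (Y := X.T.T) (D (X := X.T) (Y := X.T) (fibreSMul C)) θ) =
      D (X := X.T.T) (Y := X.T.T) (fibreSMul (X := X.T) C)
        (D (X := X.T.T) (Y := X.T.T) canonicalFlip θ) := by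
    intro θ
    rw [← D_comp_apply (X := X.T.T) (Y := X.T.T) (Z := X.T.T) θ (hd contMDiff_flip _) (hd hDm _),
      ← D_comp_apply (X := X.T.T) (Y := X.T.T) (Z := X.T.T) θ (hd hm' _) (hd contMDiff_flip _)]
    congr 1
    funext a
    exact flip_D_smul C a
  simp only [lift, Function.comp_apply]
  rw [flip_smul, e1, flip_D_smul (X := X.T), flip_D_D (X := X.T) (Y := X.T) isOpen_univ
    hm.contMDiffOn _ trivial, D_fibreSMul (X := X.T.T) (Y := X.T.T), e2]

theorem IsHomogeneousField.lift (h : IsHomogeneousField U S) :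
    IsHomogeneousField (X := X.T) (liftSet U) (lift S) where
  isOpen := isOpen_liftSet h.isOpen
  smooth _ hξ := (h.contMDiffAt_lift hξ).contMDiffWithinAt
  smul_mem C hC ξ hξ := by
    change (canonicalFlip (fibreSMul (X := X.T) C ξ)).proj ∈ U
    rw [flip_smul, D_smul]
    exact h.smul_mem C hC _ hξ
  map_smul _ hC _ hξ := h.lift_smul hC hξ

/-- `γ` is a smooth solution of `γ'' = S ∘ γ'` with `γ'` in `U`, on the open interval `I`. -/
structure IsGeo (U : Set X.T.M) (S : X.T.M → X.T.T.M) (I : Set ℝ) (γ : ℝ → X.M) : Prop where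
  isOpen : IsOpen I
  ordConnected : I.OrdConnected
  smooth : ContMDiffOn 𝓘(ℝ, ℝ) X.I ∞ γ I
  regular : ∀ t ∈ I, tangent γ t ∈ U
  equation : ∀ t ∈ I, tangent (X := X.T) (tangent γ) t = S (tangent γ t)

variable {I : Set ℝ} {γ : ℝ → X.M}

theorem tangent_congr {γ' : ℝ → X.M} {t : ℝ} (h : γ =ᶠ[𝓝 t] γ') : tangent γ t = tangent γ' t :=
  (dir_congr h 1).self_of_nhds

theorem tangent_congr_on {γ' : ℝ → X.M} (hI : IsOpen I) (h : ∀ t ∈ I, γ t = γ' t) {t : ℝ}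
    (ht : t ∈ I) : tangent γ t = tangent γ' t :=
  tangent_congr (by filter_upwards [hI.mem_nhds ht] using h)

theorem tangent_comp {f : X.M → Y.M} {t : ℝ} (hf : ContMDiffAt X.I Y.I ∞ f (γ t))
    (hγ : ContMDiffAt 𝓘(ℝ, ℝ) X.I ∞ γ t) : tangent (f ∘ γ) t = D f (tangent γ t) :=
  (D_dir 1 (hf.mdifferentiableAt (by simp)) (mdifferentiableAt_of_contMDiffAt hγ)).symm

theorem contMDiffAt_tangent {t : ℝ} (hγ : ContMDiffAt 𝓘(ℝ, ℝ) X.I ∞ γ t) :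
    ContMDiffAt 𝓘(ℝ, ℝ) X.T.I ∞ (tangent γ) t :=
  contMDiffAt_dir hγ 1

theorem IsGeo.contMDiffAt (h : IsGeo U S I γ) {t : ℝ} (ht : t ∈ I) :
    ContMDiffAt 𝓘(ℝ, ℝ) X.I ∞ γ t :=
  h.smooth.contMDiffAt (h.isOpen.mem_nhds ht)

/-- The geodesic equation of a complete lift, in terms of the flipped velocity. -/
theorem lift_equation_iff {J : ℝ → X.T.M} {t : ℝ} (hJ : ContMDiffAt 𝓘(ℝ, ℝ) X.T.I ∞ J t) :
    tangent (X := X.T.T) (tangent (X := X.T) J) t = lift S (tangent (X := X.T) J t) ↔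
      canonicalFlip (X := X.T) (tangent (X := X.T.T)
        (canonicalFlip ∘ tangent (X := X.T) J) t) =
      D (X := X.T) (Y := X.T.T) S (canonicalFlip (tangent (X := X.T) J t)) := by
  rw [tangent_comp (X := X.T.T) (Y := X.T.T) contMDiff_flip.contMDiffAt
    (contMDiffAt_tangent (X := X.T) hJ)]
  simp only [lift, Function.comp_apply]
  constructor
  · intro h
    rw [h, D_flip_D_flip, flip_flip]
  · intro h
    rw [← h, flip_flip, D_flip_D_flip]

theorem tangent_affine {t₀ C t : ℝ} (hγ : ContMDiffAt 𝓘(ℝ, ℝ) X.I ∞ γ (C * t + t₀)) :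
    tangent (fun t => γ (C * t + t₀)) t = fibreSMul C (tangent γ (C * t + t₀)) := by
  have hL : HasFDerivAt (fun t : ℝ => C * t + t₀) (C • ContinuousLinearMap.id ℝ ℝ) t := by
    exact ((hasFDerivAt_id t).const_mul C).add_const t₀
  have h := dir_comp_line (q := t) (1 : ℝ) (mdifferentiableAt_of_contMDiffAt hγ) hL
  refine h.trans ?_
  unfold dir fibreSMul
  congr 1
  exact map_smul (mfderiv 𝓘(ℝ, ℝ) X.I γ (C * t + t₀)) C (1 : ℝ)

/-- The chain rule gives velocity `C j'` and second tangent `C · Dm_C(j'')`, which is `S(C j')` by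
homogeneity. -/
theorem IsGeo.affine (hS : IsHomogeneousField U S) (h : IsGeo U S I γ) (t₀ : ℝ) {C : ℝ}
    (hC : 0 < C) : IsGeo U S {t | C * t + t₀ ∈ I} (fun t => γ (C * t + t₀)) := by
  have hcont : Continuous fun t : ℝ => C * t + t₀ := by fun_prop
  have hopen := h.isOpen.preimage hcont
  have hA : ContMDiff 𝓘(ℝ, ℝ) 𝓘(ℝ, ℝ) ∞ fun t : ℝ => C * t + t₀ := by
    apply ContDiff.contMDiff; fun_prop
  have e1 : ∀ t ∈ {t | C * t + t₀ ∈ I}, tangent (fun t => γ (C * t + t₀)) t =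
      fibreSMul C (tangent γ (C * t + t₀)) := fun t ht => tangent_affine (h.contMDiffAt ht)
  refine ⟨hopen, ?_, ?_, ?_, ?_⟩
  · refine h.ordConnected.preimage_mono ?_
    intro a b hab
    have := mul_le_mul_of_nonneg_left hab hC.le
    simpa using this
  · exact h.smooth.comp hA.contMDiffOn (fun t ht => ht)
  · intro t ht
    rw [e1 t ht]
    exact hS.smul_mem C hC _ (h.regular _ ht)
  · intro t ht
    rw [tangent_congr_on (X := X.T) hopen e1 ht, e1 t ht, hS.map_smul C hC _ (h.regular _ ht),
      ← h.equation _ ht]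
    have h1 := contMDiffAt_tangent (h.contMDiffAt ht)
    rw [← tangent_comp (X := X.T) (Y := X.T) (contMDiff_smul C).contMDiffAt h1]
    exact tangent_affine (X := X.T) (γ := fibreSMul C ∘ tangent γ)
      ((contMDiff_smul C).contMDiffAt.comp _ h1)

/-- Take base points in `κ ∂ₜ(κ J') = DS(κ J')`. Since `π ∘ κ = Dπ`, the left side gives `∂ₜ` of
`π(κ J') = (π ∘ J)'`, and the right side gives `S` of it. -/
theorem IsGeo.proj {J : ℝ → X.T.M} (h : IsGeo (X := X.T) (liftSet U) (lift S) I J) :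
    IsGeo U S I (fun t => (J t).proj) := by
  have e1 : ∀ t ∈ I, tangent (fun t => (J t).proj) t =
      (canonicalFlip (tangent (X := X.T) J t)).proj := fun t ht => by
    rw [← D_proj]
    exact tangent_comp (X := X.T) (f := fun ξ : X.T.M => ξ.proj) contMDiff_proj.contMDiffAt
      (h.contMDiffAt ht)
  refine ⟨h.isOpen, h.ordConnected, contMDiff_proj.comp_contMDiffOn h.smooth, ?_, ?_⟩
  · intro t ht
    rw [e1 t ht]
    exact h.regular t ht
  · intro t ht
    have h1 := (lift_equation_iff (h.contMDiffAt ht)).1 (h.equation t ht)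
    rw [tangent_congr_on (X := X.T) h.isOpen e1 ht, e1 t ht]
    have h2 := tangent_comp (X := X.T.T) (Y := X.T) (f := fun ξ : X.T.T.M => ξ.proj)
      (γ := canonicalFlip ∘ tangent (X := X.T) J) (t := t)
      (contMDiff_proj (X := X.T)).contMDiffAt
      (contMDiff_flip.contMDiffAt.comp t (contMDiffAt_tangent (X := X.T) (h.contMDiffAt ht)))
    refine h2.trans ?_
    rw [D_proj (X := X.T), h1]
    rfl

theorem vecAt_mk (p : X.M) (v : TangentSpace X.I p) : vecAt p (⟨p, v⟩ : X.T.M) = v := by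
  unfold vecAt
  rw [dif_pos rfl]

theorem fibreComb_mk (α β : ℝ) (p : X.M) (v w : TangentSpace X.I p) :
    fibreComb α β (⟨p, v⟩ : X.T.M) ⟨p, w⟩ = ⟨p, α • v + β • w⟩ := by
  unfold fibreComb
  rw [vecAt_mk]

theorem exists_mk_of_proj {x : X.M} {ξ : X.T.M} (h : ξ.proj = x) :
    ∃ v : TangentSpace X.I x, ξ = ⟨x, v⟩ := by
  subst h
  exact ⟨ξ.snd, rfl⟩

theorem D_fibreComb (f : X.M → Y.M) (α β : ℝ) (ξ η : X.T.M) (h : η.proj = ξ.proj) :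
    D f (fibreComb α β ξ η) = fibreComb α β (D f ξ) (D f η) := by
  obtain ⟨w, rfl⟩ := exists_mk_of_proj h
  have h1 := fibreComb_mk α β ξ.proj ξ.snd w
  have h2 := fibreComb_mk α β (f ξ.proj) (mfderiv X.I Y.I f ξ.proj ξ.snd) (mfderiv X.I Y.I f ξ.proj w)
  refine (congrArg (D f) h1).trans (Eq.trans ?_ h2.symm)
  unfold D tangentMap
  congr 1
  simp only [map_add, map_smul]

theorem extChartAt_fibreComb (q ξ η : X.T.M) (α β : ℝ) (h : η.proj = ξ.proj)
    (hq : ξ.proj ∈ (extChartAt X.I q.proj).source) :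
    extChartAt X.T.I q (fibreComb α β ξ η) = ((extChartAt X.T.I q ξ).1,
      α • (extChartAt X.T.I q ξ).2 + β • (extChartAt X.T.I q η).2) := by
  obtain ⟨w, rfl⟩ := exists_mk_of_proj h
  rw [extChartAt_source] at hq
  have h1 := fibreComb_mk α β ξ.proj ξ.snd w
  refine (congrArg (extChartAt X.T.I q) h1).trans ?_
  rw [extChartAt_totalSpace _ _ hq, extChartAt_totalSpace q ⟨ξ.proj, w⟩ hq,
    extChartAt_totalSpace q ⟨ξ.proj, α • ξ.snd + β • w⟩ hq]
  refine Prod.ext rfl ?_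
  simp only [map_add, map_smul]
  rfl

theorem contMDiffAt_fibreComb {a b : ℝ → X.T.M} {t : ℝ} (α β : ℝ)
    (ha : ContMDiffAt 𝓘(ℝ, ℝ) X.T.I ∞ a t) (hb : ContMDiffAt 𝓘(ℝ, ℝ) X.T.I ∞ b t)
    (h : ∀ᶠ s in 𝓝 t, (b s).proj = (a s).proj) :
    ContMDiffAt 𝓘(ℝ, ℝ) X.T.I ∞ (fun s => fibreComb α β (a s) (b s)) t := by
  have h1 := (contMDiffAt_T_iff.1 ha).2
  have h2 := (contMDiffAt_T_iff.1 hb).2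
  rw [extChartAt_T_congr (q := b t) (q' := a t) h.self_of_nhds] at h2
  refine contMDiffAt_T_iff.2 ⟨(contMDiffAt_T_iff.1 ha).1, ?_⟩
  rw [extChartAt_T_congr (q := fibreComb α β (a t) (b t)) (q' := a t) rfl]
  refine ((h1.const_smul α).add (h2.const_smul β)).congr_of_eventuallyEq ?_
  filter_upwards [h, eventually_chart (contMDiffAt_T_iff.1 ha).1 _ (mem_extChartAt_source _)]
    with s hs hs'
  rw [extChartAt_fibreComb _ _ _ _ _ hs hs'.1]

theorem tangent_eq_chart {a : ℝ → X.T.M} {t : ℝ} (ha : ContMDiffAt 𝓘(ℝ, ℝ) X.T.I ∞ a t)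
    {ξ : X.T.M} (hξ : a t = ξ) (q : X.T.M) (hq : q.proj = ξ.proj) {v : X.E × X.E}
    (hv : HasDerivAt (extChartAt X.T.I q ∘ a) v t) :
    tangent (X := X.T) a t = (⟨ξ, v⟩ : X.T.T.M) := by
  subst hξ
  rw [extChartAt_T_congr hq] at hv
  exact tangent_eq (X := X.T) a t v ha.continuousAt hv

/-- Flipped tangents of fibrewise linear combinations are fibrewise linear combinations. -/
theorem flip_tangent_fibreComb {a b : ℝ → X.T.M} {t : ℝ} (α β : ℝ)
    (ha : ContMDiffAt 𝓘(ℝ, ℝ) X.T.I ∞ a t) (hb : ContMDiffAt 𝓘(ℝ, ℝ) X.T.I ∞ b t)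
    (h : ∀ᶠ s in 𝓝 t, (b s).proj = (a s).proj) :
    canonicalFlip (tangent (X := X.T) (fun s => fibreComb α β (a s) (b s)) t) =
      fibreComb (X := X.T) α β (canonicalFlip (tangent (X := X.T) a t))
        (canonicalFlip (tangent (X := X.T) b t)) := by
  obtain ⟨w, hw⟩ := exists_mk_of_proj h.self_of_nhds
  have hab : fibreComb α β (a t) (b t) = ⟨(a t).proj, α • (a t).snd + β • w⟩ := by
    rw [hw]; exact fibreComb_mk α β (a t).proj (a t).snd w
  obtain ⟨⟨A1, A2⟩, dA⟩ : ∃ v : X.E × X.E, HasDerivAt (extChartAt X.T.I (a t) ∘ a) v t :=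
    ⟨_, ((contDiffAt_chart ha (a t) (mem_extChartAt_source _)).differentiableAt
      (by simp)).hasDerivAt⟩
  obtain ⟨⟨B1, B2⟩, dB⟩ : ∃ v : X.E × X.E, HasDerivAt (extChartAt X.T.I (a t) ∘ b) v t :=
    ⟨_, ((contDiffAt_chart hb (a t) ((mem_chart_source_T _ _).2 (by
      rw [h.self_of_nhds]; exact mem_extChartAt_source _))).differentiableAt (by simp)).hasDerivAt⟩
  have h1 : HasDerivAt (fun s => (extChartAt X.T.I (a t) (a s)).1) A1 t :=
    (ContinuousLinearMap.fst ℝ X.E X.E).hasFDerivAt.comp_hasDerivAt t dA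
  have h2 : HasDerivAt (fun s => (extChartAt X.T.I (a t) (a s)).2) A2 t :=
    (ContinuousLinearMap.snd ℝ X.E X.E).hasFDerivAt.comp_hasDerivAt t dA
  have h3 : HasDerivAt (fun s => (extChartAt X.T.I (a t) (b s)).1) B1 t :=
    (ContinuousLinearMap.fst ℝ X.E X.E).hasFDerivAt.comp_hasDerivAt t dB
  have h4 : HasDerivAt (fun s => (extChartAt X.T.I (a t) (b s)).2) B2 t :=
    (ContinuousLinearMap.snd ℝ X.E X.E).hasFDerivAt.comp_hasDerivAt t dB
  -- Both curves lie over the same curve in `X`, so their base velocities agree and the flipped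
  -- tangents share a fibre.
  obtain rfl : B1 = A1 := by
    refine h3.unique (h1.congr_of_eventuallyEq ?_)
    filter_upwards [h] with s hs
    exact congrArg (extChartAt X.I (a t).proj) hs
  have d2 : HasDerivAt (extChartAt X.T.I (a t) ∘ fun s => fibreComb α β (a s) (b s))
      (B1, α • A2 + β • B2) t := by
    refine (h1.prodMk ((h2.const_smul α).add (h4.const_smul β))).congr_of_eventuallyEq ?_
    filter_upwards [h, eventually_chart (contMDiffAt_T_iff.1 ha).1 _ (mem_extChartAt_source _)]
      with s hs hs'
    exact extChartAt_fibreComb _ _ _ _ _ hs hs'.1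
  rw [tangent_eq_chart (contMDiffAt_fibreComb α β ha hb h) hab (a t) rfl d2,
    tangent_eq_chart ha rfl (a t) rfl dA, tangent_eq_chart hb hw (a t) rfl dB]
  exact (fibreComb_mk (X := X.T) α β ⟨(a t).proj, B1⟩ ((a t).snd, A2) (w, B2)).symm

/-- Applying `J ↦ κ J'` twice is compatible with combinations over a common base curve, and `DS` is
linear on fibres. Regularity involves only the velocity of the projected curve, so no coefficients
have to be excluded. -/
theorem IsGeo.fibreComb {j k : ℝ → X.T.M} (α β : ℝ)
    (hj : IsGeo (X := X.T) (liftSet U) (IteratedTangent.lift S) I j)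
    (hk : IsGeo (X := X.T) (liftSet U) (IteratedTangent.lift S) I k)
    (h : ∀ t ∈ I, (j t).proj = (k t).proj) :
    IsGeo (X := X.T) (liftSet U) (IteratedTangent.lift S) I
      (fun t => fibreComb α β (j t) (k t)) := by
  have hev : ∀ t ∈ I, ∀ᶠ s in 𝓝 t, (k s).proj = (j s).proj := fun t ht => by
    filter_upwards [hj.isOpen.mem_nhds ht] with s hs using (h s hs).symm
  have hsm : ∀ t ∈ I, ContMDiffAt 𝓘(ℝ, ℝ) X.T.I ∞ (fun t => IteratedTangent.fibreComb α β (j t) (k t)) t :=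
    fun t ht => contMDiffAt_fibreComb α β (hj.contMDiffAt ht) (hk.contMDiffAt ht) (hev t ht)
  have e1 : ∀ t ∈ I, (canonicalFlip ∘ tangent (X := X.T)
      (fun t => IteratedTangent.fibreComb α β (j t) (k t))) t =
      IteratedTangent.fibreComb (X := X.T) α β (canonicalFlip (tangent (X := X.T) j t))
        (canonicalFlip (tangent (X := X.T) k t)) := fun t ht =>
    flip_tangent_fibreComb α β (hj.contMDiffAt ht) (hk.contMDiffAt ht) (hev t ht)
  have hproj : ∀ t ∈ I, (canonicalFlip (tangent (X := X.T) k t)).proj =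
      (canonicalFlip (tangent (X := X.T) j t)).proj := fun t ht => by
    rw [← D_proj, ← D_proj]
    rw [← tangent_comp (X := X.T) (f := fun ξ : X.T.M => ξ.proj) contMDiff_proj.contMDiffAt
      (hj.contMDiffAt ht), ← tangent_comp (X := X.T) (f := fun ξ : X.T.M => ξ.proj)
      contMDiff_proj.contMDiffAt (hk.contMDiffAt ht)]
    exact tangent_congr_on hj.isOpen (fun s hs => (h s hs).symm) ht
  refine ⟨hj.isOpen, hj.ordConnected, fun t ht => (hsm t ht).contMDiffWithinAt, ?_, ?_⟩
  · intro t ht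
    have := e1 t ht
    change (canonicalFlip _).proj ∈ U
    rw [Function.comp_apply] at this
    rw [this]
    exact hj.regular t ht
  · intro t ht
    have hfl : ∀ {J : ℝ → X.T.M}, ContMDiffAt 𝓘(ℝ, ℝ) X.T.I ∞ J t →
        ContMDiffAt 𝓘(ℝ, ℝ) X.T.T.I ∞ (canonicalFlip ∘ tangent (X := X.T) J) t := fun hJ =>
      contMDiff_flip.contMDiffAt.comp t (contMDiffAt_tangent (X := X.T) hJ)
    rw [lift_equation_iff (hsm t ht), tangent_congr_on (X := X.T.T) hj.isOpen e1 ht]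
    have h2 := flip_tangent_fibreComb (X := X.T) α β (hfl (hj.contMDiffAt ht))
      (hfl (hk.contMDiffAt ht)) (by filter_upwards [hj.isOpen.mem_nhds ht] with s hs using hproj s hs)
    refine h2.trans ?_
    rw [(lift_equation_iff (hj.contMDiffAt ht)).1 (hj.equation t ht),
      (lift_equation_iff (hk.contMDiffAt ht)).1 (hk.equation t ht),
      ← D_fibreComb (X := X.T) (Y := X.T.T) S α β _ _ (hproj t ht)]
    rw [← e1 t ht]
    rfl

end Lift

/-! ### Flip invariance and variations through geodesics -/

section Geodesics

variable {X Y : Mfd.{u}} {U : Set X.T.M} {S : X.T.M → X.T.T.M} {I : Set ℝ}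

theorem mdifferentiableAt_D_flip (ξ : X.T.T.T.M) : MDifferentiableAt X.T.T.T.I X.T.T.T.I
    (D (X := X.T.T) (Y := X.T.T) canonicalFlip) ξ :=
  (contMDiff_D (X := X.T.T) (Y := X.T.T) contMDiff_flip).contMDiffAt.mdifferentiableAt (by simp)

theorem D_flip_braid (ξ : X.T.T.T.T.M) :
    D (X := X.T.T.T) (Y := X.T.T.T) (D (X := X.T.T) (Y := X.T.T) canonicalFlip)
      (D (X := X.T.T.T) (Y := X.T.T.T) (canonicalFlip (X := X.T))
        (D (X := X.T.T.T) (Y := X.T.T.T) (D (X := X.T.T) (Y := X.T.T) canonicalFlip) ξ)) =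
    D (X := X.T.T.T) (Y := X.T.T.T) (canonicalFlip (X := X.T))
      (D (X := X.T.T.T) (Y := X.T.T.T) (D (X := X.T.T) (Y := X.T.T) canonicalFlip)
        (D (X := X.T.T.T) (Y := X.T.T.T) (canonicalFlip (X := X.T)) ξ)) := by
  have h1 := mdifferentiableAt_D_flip (X := X)
  have h2 := mdifferentiableAt_flip (X := X.T)
  rw [← D_comp_apply (X := X.T.T.T) (Y := X.T.T.T) (Z := X.T.T.T) ξ (h2 _) (h1 _),
    ← D_comp_apply (X := X.T.T.T) (Y := X.T.T.T) (Z := X.T.T.T) ξ (h1 _) ((h2 _).comp _ (h1 _)),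
    ← D_comp_apply (X := X.T.T.T) (Y := X.T.T.T) (Z := X.T.T.T) ξ (h1 _) (h2 _),
    ← D_comp_apply (X := X.T.T.T) (Y := X.T.T.T) (Z := X.T.T.T) ξ (h2 _) ((h1 _).comp _ (h2 _))]
  congr 1
  funext η
  exact flip_braid η

theorem D_flip_mem_liftSet_liftSet {ξ : X.T.T.T.M} (hξ : ξ ∈ liftSet (X := X.T) (liftSet U)) :
    D (X := X.T.T) (Y := X.T.T) canonicalFlip ξ ∈ liftSet (X := X.T) (liftSet U) := by
  rw [D_flip]
  exact hξ

theorem IsHomogeneousField.D_lift (h : IsHomogeneousField U S) {η : X.T.T.T.M}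
    (hη : η.proj ∈ liftSet U) :
    D (X := X.T.T) (Y := X.T.T.T) (IteratedTangent.lift S) η =
      D (X := X.T.T.T) (Y := X.T.T.T) (D (X := X.T.T) (Y := X.T.T) canonicalFlip)
        (D (X := X.T.T.T) (Y := X.T.T.T) (canonicalFlip (X := X.T))
          (D (X := X.T.T) (Y := X.T.T.T) (D (X := X.T) (Y := X.T.T) S)
            (D (X := X.T.T) (Y := X.T.T) canonicalFlip η))) := by
  have h1 := mdifferentiableAt_D_flip (X := X)
  have h2 := mdifferentiableAt_flip (X := X.T)
  have h3 := mdifferentiableAt_flip (X := X) η.proj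
  have h4 : MDifferentiableAt X.T.T.I X.T.T.T.I (D (X := X.T) (Y := X.T.T) S)
      (canonicalFlip η.proj) :=
    (contMDiffAt_D (X := X.T) (Y := X.T.T) h.isOpen h.smooth _ hη).mdifferentiableAt (by simp)
  have h43 := MDifferentiableAt.comp (I' := X.T.T.I) η.proj h4 h3
  have h243 := MDifferentiableAt.comp (I' := X.T.T.T.I) η.proj (h2 _) h43
  unfold IteratedTangent.lift
  rw [D_comp_apply (X := X.T.T) (Y := X.T.T.T) (Z := X.T.T.T) η (h1 _) h243,
    D_comp_apply (X := X.T.T) (Y := X.T.T.T) (Z := X.T.T.T) η (h2 _) h43,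
    D_comp_apply (X := X.T.T) (Y := X.T.T) (Z := X.T.T.T) η h4 h3]

/-- The second complete lift is invariant under the canonical flip. -/
theorem IsHomogeneousField.lift_lift_D_flip (h : IsHomogeneousField U S) {ξ : X.T.T.T.M}
    (hξ : ξ ∈ liftSet (X := X.T) (liftSet U)) :
    IteratedTangent.lift (X := X.T) (IteratedTangent.lift S)
        (D (X := X.T.T) (Y := X.T.T) canonicalFlip ξ) =
      D (X := X.T.T.T) (Y := X.T.T.T) (D (X := X.T.T) (Y := X.T.T) canonicalFlip)
        (IteratedTangent.lift (X := X.T) (IteratedTangent.lift S) ξ) := by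
  -- With `κ`, `κ'`, `κ''` the flips of `TTX`, `TTTX`, `TTTTX`, this is `S^cc = Dκ' DDκ κ'' Dκ' DDS
  -- Dκ κ'`, after moving `κ''` past `DDκ` by naturality.
  have key : ∀ {ζ : X.T.T.T.M} (_ : ζ ∈ liftSet (X := X.T) (liftSet U)),
      IteratedTangent.lift (X := X.T) (IteratedTangent.lift S) ζ =
      D (X := X.T.T.T) (Y := X.T.T.T) (canonicalFlip (X := X.T))
        (D (X := X.T.T.T) (Y := X.T.T.T) (D (X := X.T.T) (Y := X.T.T) canonicalFlip)
          (canonicalFlip (X := X.T.T) (D (X := X.T.T.T) (Y := X.T.T.T) (canonicalFlip (X := X.T))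
          (D (X := X.T.T) (Y := X.T.T.T) (D (X := X.T) (Y := X.T.T) S)
            (D (X := X.T.T) (Y := X.T.T) canonicalFlip (canonicalFlip (X := X.T) ζ)))))) := by
    intro ζ hζ
    rw [IteratedTangent.lift]
    simp only [Function.comp_apply]
    rw [h.D_lift hζ, flip_D_D (X := X.T.T) (Y := X.T.T) isOpen_univ contMDiff_flip.contMDiffOn _
      trivial]
  -- At `Dκ ξ` the braid relation turns the innermost factors into `κ' Dκ κ'`; naturality carries
  -- the leading `κ'` through `DDS` as `κ''`; two further braid moves bring it out on the left as
  -- `DDκ`.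
  rw [key (D_flip_mem_liftSet_liftSet hξ), key hξ, flip_braid, ← flip_D_D (X := X.T) (Y := X.T.T)
    h.isOpen h.smooth _ (by rw [D_flip]; exact hξ), ← flip_braid (X := X.T), ← D_flip_braid]

theorem IsGeo.flip (hS : IsHomogeneousField U S) {j : ℝ → X.T.T.M}
    (h : IsGeo (X := X.T.T) (liftSet (X := X.T) (liftSet U))
      (IteratedTangent.lift (X := X.T) (IteratedTangent.lift S)) I j) :
    IsGeo (X := X.T.T) (liftSet (X := X.T) (liftSet U))
      (IteratedTangent.lift (X := X.T) (IteratedTangent.lift S)) I (fun t => canonicalFlip (j t)) := by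
  have e1 : ∀ t ∈ I, tangent (X := X.T.T) (fun t => canonicalFlip (j t)) t =
      D (X := X.T.T) (Y := X.T.T) canonicalFlip (tangent (X := X.T.T) j t) := fun t ht =>
    tangent_comp (X := X.T.T) (Y := X.T.T) contMDiff_flip.contMDiffAt (h.contMDiffAt ht)
  refine ⟨h.isOpen, h.ordConnected, contMDiff_flip.comp_contMDiffOn h.smooth, ?_, ?_⟩
  · intro t ht
    rw [e1 t ht]
    exact D_flip_mem_liftSet_liftSet (h.regular t ht)
  · intro t ht
    rw [tangent_congr_on (X := X.T.T.T) h.isOpen e1 ht, e1 t ht,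
      hS.lift_lift_D_flip (h.regular t ht), ← h.equation t ht]
    exact tangent_comp (X := X.T.T.T) (Y := X.T.T.T)
      (contMDiff_D (X := X.T.T) (Y := X.T.T) contMDiff_flip).contMDiffAt
      (contMDiffAt_tangent (X := X.T.T) (h.contMDiffAt ht))

theorem tangent_slice_fst {c : ℝ × ℝ → X.M} {t s : ℝ}
    (hc : MDifferentiableAt 𝓘(ℝ, ℝ × ℝ) X.I c (t, s)) :
    tangent (fun t => c (t, s)) t = dir c (1, 0) (t, s) := by
  have hL : HasFDerivAt (fun t : ℝ => (t, s)) (ContinuousLinearMap.inl ℝ ℝ ℝ) t :=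
    hasFDerivAt_prodMk_left t s
  exact (dir_comp_line (c := c) (L := fun t : ℝ => (t, s)) (1 : ℝ) hc hL).trans (by simp)

theorem tangent_slice_snd {c : ℝ × ℝ → X.M} {t s : ℝ}
    (hc : MDifferentiableAt 𝓘(ℝ, ℝ × ℝ) X.I c (t, s)) :
    tangent (fun s => c (t, s)) s = dir c (0, 1) (t, s) := by
  have hL : HasFDerivAt (fun s : ℝ => (t, s)) (ContinuousLinearMap.inr ℝ ℝ ℝ) s :=
    hasFDerivAt_prodMk_right t s
  exact (dir_comp_line (c := c) (L := fun s : ℝ => (t, s)) (1 : ℝ) hc hL).trans (by simp)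

/-- The variation field of a variation through solutions solves the lifted equation. -/
theorem IsGeo.of_variation (hS : IsHomogeneousField U S) (hI : IsOpen I) (hI' : I.OrdConnected)
    {W : Set (ℝ × ℝ)} (hW : IsOpen W) (hIW : ∀ t ∈ I, (t, (0 : ℝ)) ∈ W) {c : ℝ × ℝ → X.M}
    (hc : ContMDiffOn 𝓘(ℝ, ℝ × ℝ) X.I ∞ c W)
    (hreg : ∀ t s, (t, s) ∈ W → tangent (fun t => c (t, s)) t ∈ U)
    (heq : ∀ t s, (t, s) ∈ W → tangent (X := X.T) (tangent fun t => c (t, s)) t =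
      S (tangent (fun t => c (t, s)) t)) :
    IsGeo (X := X.T) (liftSet U) (IteratedTangent.lift S) I
      (fun t => tangent (fun s => c (t, s)) 0) := by
  have hca : ∀ p ∈ W, ContMDiffAt 𝓘(ℝ, ℝ × ℝ) X.I ∞ c p := fun p hp =>
    hc.contMDiffAt (hW.mem_nhds hp)
  have hdd : ∀ {Z : Mfd.{u}} {f g : ℝ × ℝ → Z.M} (_ : ∀ p ∈ W, f p = g p) (v p : ℝ × ℝ) (_ : p ∈ W),
      dir f v p = dir g v p := fun hfg v p hp =>
    (dir_congr (by filter_upwards [hW.mem_nhds hp] using hfg) v).self_of_nhds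
  have hlineW : ∀ t s, (t, s) ∈ W → ∀ᶠ a in 𝓝 t, (a, s) ∈ W := fun t s h =>
    (by fun_prop : Continuous fun a : ℝ => (a, s)).continuousAt.preimage_mem_nhds (hW.mem_nhds h)
  have sl : ∀ t s, (t, s) ∈ W → tangent (fun t => c (t, s)) t = dir c (1, 0) (t, s) :=
    fun t s h => tangent_slice_fst (mdifferentiableAt_of_contMDiffAt (hca _ h))
  have sl2 : ∀ t s, (t, s) ∈ W → tangent (X := X.T) (tangent fun t => c (t, s)) t =
      dir (X := X.T) (dir c (1, 0)) (1, 0) (t, s) := by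
    intro t s h
    rw [← tangent_slice_fst (X := X.T)
      (mdifferentiableAt_of_contMDiffAt (contMDiffAt_dir (hca _ h) _))]
    refine tangent_congr (X := X.T) ?_
    filter_upwards [hlineW t s h] with a ha using sl a s ha
  have hmem : ∀ p ∈ W, dir c (1, 0) p ∈ U := fun p hp => by
    rw [← sl p.1 p.2 hp]; exact hreg p.1 p.2 hp
  have hgeo : ∀ p ∈ W, dir (X := X.T) (dir c (1, 0)) (1, 0) p = S (dir c (1, 0) p) := fun p hp => by
    rw [← sl p.1 p.2 hp, ← heq p.1 p.2 hp]; exact (sl2 p.1 p.2 hp).symm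
  have hJ : ∀ t ∈ I, tangent (fun s => c (t, s)) 0 = dir c (0, 1) (t, 0) := fun t ht =>
    tangent_slice_snd (mdifferentiableAt_of_contMDiffAt (hca _ (hIW t ht)))
  have hJ1 : ∀ t ∈ I, tangent (X := X.T) (fun t => tangent (fun s => c (t, s)) 0) t =
      dir (X := X.T) (dir c (0, 1)) (1, 0) (t, 0) := fun t ht => by
    rw [tangent_congr_on (X := X.T) hI hJ ht]
    exact tangent_slice_fst (X := X.T)
      (mdifferentiableAt_of_contMDiffAt (contMDiffAt_dir (hca _ (hIW t ht)) _))
  have hJ2 : ∀ t ∈ I, tangent (X := X.T.T) (tangent (X := X.T)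
      fun t => tangent (fun s => c (t, s)) 0) t =
      dir (X := X.T.T) (dir (X := X.T) (dir c (0, 1)) (1, 0)) (1, 0) (t, 0) := fun t ht => by
    rw [tangent_congr_on (X := X.T.T) hI hJ1 ht]
    exact tangent_slice_fst (X := X.T.T) (mdifferentiableAt_of_contMDiffAt
      (contMDiffAt_dir (X := X.T) (contMDiffAt_dir (hca _ (hIW t ht)) _) _))
  have hfl : ∀ v w, ∀ p ∈ W, canonicalFlip (dir (X := X.T) (dir c v) w p) =
      dir (X := X.T) (dir c w) v p := fun v w p hp => flip_dir_dir c v w p (hca p hp)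
  refine ⟨hI, hI', ?_, ?_, ?_⟩
  · have hline : ContMDiffOn 𝓘(ℝ, ℝ) 𝓘(ℝ, ℝ × ℝ) ∞ (fun t : ℝ => (t, (0 : ℝ))) I :=
      (by fun_prop : ContDiff ℝ ∞ fun t : ℝ => (t, (0 : ℝ))).contMDiff.contMDiffOn
    exact ((contMDiffOn_dir hW hc (0, 1)).comp hline hIW).congr hJ
  · intro t ht
    rw [hJ1 t ht]
    change (canonicalFlip _).proj ∈ U
    rw [hfl _ _ _ (hIW t ht)]
    exact hmem _ (hIW t ht)
  · intro t ht
    have hp := hIW t ht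
    have hd1 := contMDiffAt_dir (hca _ hp) (1, 0)
    rw [hJ1 t ht, hJ2 t ht]
    -- The factors of the lift act in turn as follows: `κ` gives `∂ₛ∂ₜc`, `DS` gives `∂ₛ∂ₜ∂ₜc` by
    -- the geodesic equation on all of `W`, the next flip gives `∂ₜ∂ₛ∂ₜc`, and `Dκ` gives `∂ₜ∂ₜ∂ₛc =
    -- J''`.
    simp only [IteratedTangent.lift, Function.comp_apply]
    rw [hfl _ _ _ hp, D_dir (X := X.T) (Y := X.T.T) _ (hS.mdifferentiableAt (hmem _ hp))
      (mdifferentiableAt_of_contMDiffAt hd1),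
      ← hdd (Z := X.T.T) (f := dir (X := X.T) (dir c (1, 0)) (1, 0)) (g := S ∘ dir c (1, 0))
        hgeo _ _ hp,
      flip_dir_dir (X := X.T) _ _ _ _ hd1, D_dir (X := X.T.T) (Y := X.T.T) _
        (mdifferentiableAt_flip _)
        (mdifferentiableAt_of_contMDiffAt (contMDiffAt_dir (X := X.T) hd1 _))]
    exact hdd (Z := X.T.T) (fun p hp => (hfl _ _ p hp).symm) _ _ hp

theorem IsGeo.congr {j k : ℝ → X.M} (h : IsGeo U S I j) (hjk : ∀ t ∈ I, k t = j t) :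
    IsGeo U S I k := by
  have e1 : ∀ t ∈ I, tangent k t = tangent j t := fun t ht => tangent_congr_on h.isOpen hjk ht
  refine ⟨h.isOpen, h.ordConnected, h.smooth.congr hjk, fun t ht => ?_, fun t ht => ?_⟩
  · rw [e1 t ht]; exact h.regular t ht
  · rw [e1 t ht, tangent_congr_on (X := X.T) h.isOpen e1 ht]; exact h.equation t ht

theorem dir_smul (c : ℝ → X.M) (a p : ℝ) : dir c a p = fibreSMul a (dir c 1 p) := by
  unfold dir fibreSMul
  congr 1
  refine Eq.trans ?_ (map_smul (mfderiv 𝓘(ℝ, ℝ) X.I c p) a (1 : ℝ))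
  exact congrArg (mfderiv 𝓘(ℝ, ℝ) X.I c p) (mul_one a).symm

/-- The variation field of the time translations `j(t + s)`. -/
theorem IsGeo.tangent (hS : IsHomogeneousField U S) {j : ℝ → X.M} (h : IsGeo U S I j) :
    IsGeo (X := X.T) (liftSet U) (IteratedTangent.lift S) I (tangent j) := by
  have hW : IsOpen {p : ℝ × ℝ | p.1 + p.2 ∈ I} := h.isOpen.preimage (by fun_prop)
  have hg : ∀ s : ℝ, IsGeo U S {t | t + s ∈ I} fun t => j (t + s) := fun s => by
    simpa using h.affine hS s one_pos
  have hadd : ContMDiff 𝓘(ℝ, ℝ × ℝ) 𝓘(ℝ, ℝ) ∞ fun p : ℝ × ℝ => p.1 + p.2 := by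
    apply ContDiff.contMDiff; fun_prop
  refine (IsGeo.of_variation hS h.isOpen h.ordConnected hW (c := fun p => j (p.1 + p.2))
    (by simp) (h.smooth.comp hadd.contMDiffOn fun p hp => hp)
    (fun t s hts => (hg s).regular t hts) (fun t s hts => (hg s).equation t hts)).congr ?_
  intro t ht
  have h1 : HasFDerivAt (fun s : ℝ => t + s) (ContinuousLinearMap.id ℝ ℝ) 0 :=
    (hasFDerivAt_id (0 : ℝ)).const_add t
  have h2 := dir_comp_line (c := j) (q := (0 : ℝ)) (1 : ℝ)
    (by rw [add_zero]; exact mdifferentiableAt_of_contMDiffAt (h.contMDiffAt ht)) h1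
  rw [add_zero] at h2
  exact h2.symm

/-- The variation field of the dilations `j((1 + s) t)`. Only `1 + s > 0` is admitted, because
homogeneity holds for positive factors; this suffices near `s = 0`. -/
theorem IsGeo.smul_tangent (hS : IsHomogeneousField U S) {j : ℝ → X.M} (h : IsGeo U S I j) :
    IsGeo (X := X.T) (liftSet U) (IteratedTangent.lift S) I
      (fun t => fibreSMul t (IteratedTangent.tangent j t)) := by
  have hW : IsOpen {p : ℝ × ℝ | (1 + p.2) * p.1 ∈ I ∧ 0 < 1 + p.2} :=
    (h.isOpen.preimage (by fun_prop : Continuous fun p : ℝ × ℝ => (1 + p.2) * p.1)).inter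
      (isOpen_lt continuous_const (continuous_const.add continuous_snd))
  have hg : ∀ s : ℝ, 0 < 1 + s → IsGeo U S {t | (1 + s) * t ∈ I} fun t => j ((1 + s) * t) :=
    fun s hs => by simpa using h.affine hS 0 hs
  have hmul : ContMDiff 𝓘(ℝ, ℝ × ℝ) 𝓘(ℝ, ℝ) ∞ fun p : ℝ × ℝ => (1 + p.2) * p.1 := by
    apply ContDiff.contMDiff; fun_prop
  refine (IsGeo.of_variation hS h.isOpen h.ordConnected hW (c := fun p => j ((1 + p.2) * p.1))
    (by simp) (h.smooth.comp hmul.contMDiffOn fun p hp => hp.1)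
    (fun t s hts => (hg s hts.2).regular t hts.1)
    (fun t s hts => (hg s hts.2).equation t hts.1)).congr ?_
  intro t ht
  have h1 : HasFDerivAt (fun s : ℝ => (1 + s) * t) ((ContinuousLinearMap.id ℝ ℝ).smulRight t) 0 :=
    ((hasFDerivAt_id (0 : ℝ)).const_add 1).smul_const t
  have e0 : (1 + (0 : ℝ)) * t = t := by ring
  have h2 := dir_comp_line (c := j) (q := (0 : ℝ)) (1 : ℝ)
    (by rw [e0]; exact mdifferentiableAt_of_contMDiffAt (h.contMDiffAt ht)) h1
  rw [e0] at h2
  refine Eq.trans ?_ h2.symm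
  rw [tangent_eq_dir, ← dir_smul]
  simp

theorem fibreComb_self_zero (a : ℝ) (ξ : X.T.M) : IteratedTangent.fibreComb a 0 ξ ξ = fibreSMul a ξ := by
  obtain ⟨x, v⟩ := ξ
  rw [fibreComb_mk, zero_smul, add_zero]
  rfl

theorem IsGeo.smul {j : ℝ → X.T.M}
    (h : IsGeo (X := X.T) (liftSet U) (IteratedTangent.lift S) I j) (a : ℝ) :
    IsGeo (X := X.T) (liftSet U) (IteratedTangent.lift S) I (fun t => fibreSMul a (j t)) :=
  (h.fibreComb a 0 h fun _ _ => rfl).congr fun _ _ => (fibreComb_self_zero a _).symm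

theorem contMDiffOn_smul_curve {j : ℝ → X.T.M} (hI : IsOpen I)
    (hj : ContMDiffOn 𝓘(ℝ, ℝ) X.T.I ∞ j I) :
    ContMDiffOn 𝓘(ℝ, ℝ × ℝ) X.T.I ∞ (fun p : ℝ × ℝ => fibreSMul (1 + p.2) (j p.1))
      {p | p.1 ∈ I} := by
  intro p hp
  refine ContMDiffAt.contMDiffWithinAt ?_
  have hfst : ContMDiffAt 𝓘(ℝ, ℝ × ℝ) 𝓘(ℝ, ℝ) ∞ (fun p : ℝ × ℝ => p.1) p := contDiff_fst.contMDiff p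
  have hjp : ContMDiffAt 𝓘(ℝ, ℝ × ℝ) X.T.I ∞ (fun p : ℝ × ℝ => j p.1) p :=
    (hj.contMDiffAt (hI.mem_nhds hp)).comp p hfst
  obtain ⟨h1, h2⟩ := contMDiffAt_T_iff.1 hjp
  refine contMDiffAt_T_iff.2 ⟨h1, ?_⟩
  rw [extChartAt_T_congr (q := fibreSMul (1 + p.2) (j p.1)) (q' := j p.1) rfl]
  refine (((contDiffAt_const (c := (1 : ℝ))).add contDiffAt_snd).smul h2).congr_of_eventuallyEq ?_
  filter_upwards [eventually_chart h1 _ (mem_extChartAt_source _)] with a ha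
  rw [extChartAt_smul _ _ _ ha.1]
  rfl

/-- The variation field of `(1 + s) j(t)`, a family of geodesics for every real `s` by fibrewise
linearity. The variation takes place in `TX`, so homogeneity of the lifted field is used. -/
theorem IsGeo.liouville (hS : IsHomogeneousField U S) {j : ℝ → X.T.M}
    (h : IsGeo (X := X.T) (liftSet U) (IteratedTangent.lift S) I j) :
    IsGeo (X := X.T.T) (liftSet (X := X.T) (liftSet U))
      (IteratedTangent.lift (X := X.T) (IteratedTangent.lift S)) I
      (fun t => IteratedTangent.liouville (j t)) :=
  IsGeo.of_variation (X := X.T) hS.lift h.isOpen h.ordConnected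
    (h.isOpen.preimage continuous_fst) (fun _ ht => ht)
    (c := fun p => fibreSMul (1 + p.2) (j p.1)) (contMDiffOn_smul_curve h.isOpen h.smooth)
    (fun t s hts => (h.smul (1 + s)).regular t hts)
    (fun t s hts => (h.smul (1 + s)).equation t hts)

end Geodesics

/-! ### Liouville field and Lie bracket in charts -/

section Homogeneity

variable {X : Mfd.{u}} {S : X.T.M → X.T.T.M}

theorem isOpen_snd_ne_zero : IsOpen {ξ : X.T.M | ξ.snd ≠ 0} := by
  rw [isOpen_iff_mem_nhds]
  intro q hq
  have h1 : ∀ᶠ η in 𝓝 q, (extChartAt X.T.I q η).2 ≠ 0 := by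
    refine (continuous_snd.continuousAt.comp (continuousAt_extChartAt q)).eventually_ne ?_
    have := extChartAt_self_T q.proj q.snd q.snd
    exact fun h => hq ((congrArg Prod.snd this).symm.trans h)
  filter_upwards [h1, extChartAt_source_mem_nhds (I := X.T.I) q] with η hη hs h0
  have hs' := (mem_chart_source_T _ _).1 hs
  rw [extChartAt_source] at hs'
  refine hη ?_
  rw [extChartAt_totalSpace _ _ hs', h0]
  exact map_zero (mfderiv X.I 𝓘(ℝ, X.E) (extChartAt X.I q.proj) η.proj)

theorem mk_vecAt {p : X.M} {η : X.T.M} (h : η.proj = p) : (⟨p, vecAt p η⟩ : X.T.M) = η := by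
  subst h
  have := vecAt_mk η.proj η.snd
  exact congrArg (Bundle.TotalSpace.mk η.proj) this

theorem one_fibreSMul (ξ : X.T.M) : fibreSMul 1 ξ = ξ := by
  unfold fibreSMul
  rw [one_smul]

theorem liouville_proj (ξ : X.T.M) : (liouville ξ).proj = ξ := by
  change fibreSMul (1 + 0) ξ = ξ
  rw [add_zero, one_fibreSMul]

/-- In coordinates the Liouville field at `(x, y)` is `(0, y)`, the derivative of `(x, (1 + s) y)`
at `s = 0`. -/
theorem extChartAt_liouville (q : X.T.T.M) (η : X.T.M)
    (h : η.proj ∈ (extChartAt X.I q.proj.proj).source) :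
    (extChartAt X.T.T.I q (liouville η)).2 = ((0 : X.E), (extChartAt X.T.I q.proj η).2) := by
  have hc : ContMDiffAt 𝓘(ℝ, ℝ) X.T.I ∞ (fun s : ℝ => fibreSMul (1 + s) η) 0 := by
    refine contMDiffAt_T_iff.2 ⟨contMDiffAt_const, ?_⟩
    have : ∀ s : ℝ, extChartAt X.T.I (fibreSMul (1 + 0) η) (fibreSMul (1 + s) η) = _ := fun s =>
      extChartAt_smul (fibreSMul (1 + 0) η) η (1 + s) (mem_extChartAt_source _)
    simp only [this]
    exact ((contDiffAt_const (c := (1 : ℝ))).add contDiffAt_id).smul contDiffAt_const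
  have h1 := extChartAt_dir (X := X.T) q (fun s : ℝ => fibreSMul (1 + s) η) 1 0
    ((mem_chart_source_T _ _).2 h) (mdifferentiableAt_of_contMDiffAt hc)
  refine (congrArg Prod.snd h1).trans ?_
  have h2 : (extChartAt X.T.I q.proj ∘ fun s : ℝ => fibreSMul (1 + s) η) = fun s : ℝ =>
      ((extChartAt X.T.I q.proj η).1, (1 + s) • (extChartAt X.T.I q.proj η).2) := by
    funext s
    exact extChartAt_smul _ _ _ h
  have h3 : HasDerivAt (fun s : ℝ =>
      ((extChartAt X.T.I q.proj η).1, (1 + s) • (extChartAt X.T.I q.proj η).2))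
      ((0 : X.E), (1 : ℝ) • (extChartAt X.T.I q.proj η).2) 0 :=
    (hasDerivAt_const _ _).prodMk
      (((hasDerivAt_id (0 : ℝ)).const_add 1).smul_const (extChartAt X.T.I q.proj η).2)
  change fderiv ℝ (extChartAt X.T.I q.proj ∘ fun s : ℝ => fibreSMul (1 + s) η) 0 1 = _
  rw [h2, fderiv_apply_one_eq_deriv, h3.deriv, one_smul]

/-- The second order condition in a chart. -/
theorem extChartAt_secondOrder (q ζ : X.T.T.M) (h : ζ.proj.proj ∈ (extChartAt X.I q.proj.proj).source)
    (hζ : (canonicalFlip ζ).proj = ζ.proj) :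
    (extChartAt X.T.T.I q ζ).2.1 = (extChartAt X.T.I q.proj ζ.proj).2 := by
  have h1 := congrArg (fun w : (X.E × X.E) × X.E × X.E => w.1.2) (extChartAt_flip q q ζ h rfl)
  have h2 : (extChartAt X.T.T.I q (canonicalFlip ζ)).1 =
      extChartAt X.T.I q.proj (canonicalFlip ζ).proj := rfl
  rw [← hζ, ← h2]
  exact h1.symm

/-- A vector field pulled back by a chart, in terms of the charts of the tangent bundle. -/
theorem mpullbackWithin_extChartAt_symm (q : X.M) (V : X.M → X.T.M) (z : X.E)
    (hz : z ∈ (extChartAt X.I q).target)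
    (hV : (V ((extChartAt X.I q).symm z)).proj = (extChartAt X.I q).symm z) :
    VectorField.mpullbackWithin 𝓘(ℝ, X.E) X.I (extChartAt X.I q).symm
      (fun η => vecAt η (V η)) (Set.range X.I) z =
    (extChartAt X.T.I (⟨q, 0⟩ : X.T.M) (V ((extChartAt X.I q).symm z))).2 := by
  have hs : (extChartAt X.I q).symm z ∈ (extChartAt X.I q).source :=
    (extChartAt X.I q).map_target hz
  have hs' := hs
  rw [extChartAt_source] at hs'
  rw [VectorField.mpullbackWithin_apply]
  have h1 := mfderiv_extChartAt_comp_mfderivWithin_extChartAt_symm (I := X.I) hz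
  have h2 := mfderivWithin_extChartAt_symm_comp_mfderiv_extChartAt (I := X.I) hz
  -- Pulling back by the inverse chart applies the derivative of the chart, which is also the fibre
  -- coordinate of the induced chart of the tangent bundle.
  rw [ContinuousLinearMap.inverse_eq h2 h1]
  have h3 := extChartAt_totalSpace (⟨q, 0⟩ : X.T.M)
    (⟨(extChartAt X.I q).symm z, vecAt _ (V ((extChartAt X.I q).symm z))⟩ : X.T.M) hs'
  exact (congrArg Prod.snd h3).symm.trans
    (congrArg (fun ξ => (extChartAt X.T.I (⟨q, 0⟩ : X.T.M) ξ).2) (mk_vecAt hV))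

/-- The Lie bracket, computed in a chart. -/
theorem lieBracket_chart (q : X.M) (V W : X.M → X.T.M) (V' W' : X.E → X.E)
    (hVp : ∀ᶠ η in 𝓝 q, (V η).proj = η) (hWp : ∀ᶠ η in 𝓝 q, (W η).proj = η)
    (hV : ∀ᶠ z in 𝓝 (extChartAt X.I q q),
      (extChartAt X.T.I (⟨q, 0⟩ : X.T.M) (V ((extChartAt X.I q).symm z))).2 = V' z)
    (hW : ∀ᶠ z in 𝓝 (extChartAt X.I q q),
      (extChartAt X.T.I (⟨q, 0⟩ : X.T.M) (W ((extChartAt X.I q).symm z))).2 = W' z)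
    (h : VectorField.mlieBracket X.I (fun η => vecAt η (V η)) (fun η => vecAt η (W η)) q =
      vecAt q (W q)) :
    VectorField.lieBracket ℝ V' W' (extChartAt X.I q q) = W' (extChartAt X.I q q) := by
  have ht : ∀ᶠ z in 𝓝 (extChartAt X.I q q), z ∈ (extChartAt X.I q).target :=
    extChartAt_target_mem_nhds q
  have hsymm : Tendsto (extChartAt X.I q).symm (𝓝 (extChartAt X.I q q)) (𝓝 q) := by
    have := continuousAt_extChartAt_symm (I := X.I) q
    rwa [ContinuousAt, extChartAt_to_inv] at this
  have eV : VectorField.mpullbackWithin 𝓘(ℝ, X.E) X.I (extChartAt X.I q).symm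
      (fun η => vecAt η (V η)) (Set.range X.I) =ᶠ[𝓝 (extChartAt X.I q q)] V' := by
    filter_upwards [ht, hV, hsymm.eventually hVp] with z h1 h2 h3
    rw [← h2]
    exact mpullbackWithin_extChartAt_symm q V z h1 h3
  have eW : VectorField.mpullbackWithin 𝓘(ℝ, X.E) X.I (extChartAt X.I q).symm
      (fun η => vecAt η (W η)) (Set.range X.I) =ᶠ[𝓝 (extChartAt X.I q q)] W' := by
    filter_upwards [ht, hW, hsymm.eventually hWp] with z h1 h2 h3
    rw [← h2]
    exact mpullbackWithin_extChartAt_symm q W z h1 h3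
  rw [← VectorField.mlieBracketWithin_univ] at h
  unfold VectorField.mlieBracketWithin at h
  rw [Set.preimage_univ, Set.univ_inter] at h
  have hr : Set.range X.I = Set.univ := X.I.range_eq_univ
  have hb : VectorField.lieBracketWithin ℝ
      (VectorField.mpullbackWithin 𝓘(ℝ, X.E) X.I (extChartAt X.I q).symm
        (fun η => vecAt η (V η)) (Set.range X.I))
      (VectorField.mpullbackWithin 𝓘(ℝ, X.E) X.I (extChartAt X.I q).symm
        (fun η => vecAt η (W η)) (Set.range X.I)) (Set.range X.I) (extChartAt X.I q q) =
      VectorField.lieBracket ℝ V' W' (extChartAt X.I q q) := by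
    conv_lhs => enter [4]; rw [hr]
    exact (congrFun VectorField.lieBracketWithin_univ _).trans (eV.lieBracket_vectorField_eq eW)
  -- The bracket on the manifold is the chart bracket transported by the inverse derivative of the
  -- chart; applying that derivative to `h` undoes the transport.
  have hinv := isInvertible_mfderiv_extChartAt (I := X.I) (mem_extChartAt_source (I := X.I) q)
  have h5 := congrArg (mfderiv X.I 𝓘(ℝ, X.E) (extChartAt X.I q) q) h
  have h6 := (hinv.self_apply_inverse _).symm.trans h5
  have h7 := extChartAt_totalSpace (⟨q, 0⟩ : X.T.M) (⟨q, vecAt q (W q)⟩ : X.T.M)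
    (mem_chart_source _ _)
  have h8 := hW.self_of_nhds
  rw [extChartAt_to_inv, ← mk_vecAt hWp.self_of_nhds, h7] at h8
  exact hb.symm.trans (h6.trans h8)

end Homogeneity

/-! ### From the bracket condition to positive homogeneity -/

section BaseSpray

variable {X : Mfd.{u}} {S : X.T.M → X.T.T.M}

theorem extChartAt_T_congr' {q q' : X.T.M} (h : chartAt X.H q.proj = chartAt X.H q'.proj) :
    extChartAt X.T.I q = extChartAt X.T.I q' := by
  have h' : achart X.H q.proj = achart X.H q'.proj := Subtype.ext h
  unfold extChartAt
  rw [TangentBundle.chartAt, TangentBundle.chartAt, h, h']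

/-- The fibre part of `S` in the chart centred at `q`. -/
def chartField (S : X.T.M → X.T.T.M) (q : X.T.M) (z : X.E × X.E) : X.E × X.E :=
  (extChartAt X.T.T.I (⟨q, 0⟩ : X.T.T.M) (S ((extChartAt X.T.I q).symm z))).2

/-- One coordinate field serves the whole fibre over a base point, so it can be differentiated along
a ray in that fibre. -/
theorem chartField_congr {q q' : X.T.M} (h : q.proj = q'.proj) :
    chartField S q = chartField S q' := by
  have h1 : extChartAt X.T.I q = extChartAt X.T.I q' := extChartAt_T_congr h
  have h2 : extChartAt X.T.T.I (⟨q, 0⟩ : X.T.T.M) = extChartAt X.T.T.I (⟨q', 0⟩ : X.T.T.M) := by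
    refine extChartAt_T_congr' (X := X.T) ?_
    rw [FiberBundle.chartedSpace_chartAt, FiberBundle.chartedSpace_chartAt, h]
  unfold chartField
  rw [h1, h2]

theorem tendsto_extChartAt_symm (q : X.M) :
    Tendsto (extChartAt X.I q).symm (𝓝 (extChartAt X.I q q)) (𝓝 q) := by
  have := continuousAt_extChartAt_symm (I := X.I) q
  rwa [ContinuousAt, extChartAt_to_inv] at this

/-- Euler's theorem in degree two: by the identity, `a⁻² g(a)` has zero derivative on the connected
set `(0, ∞)`. -/
theorem eq_sq_smul_of_euler {E : Type*} [NormedAddCommGroup E] [NormedSpace ℝ E] {g g' : ℝ → E}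
    (hg : ∀ c, 0 < c → HasDerivAt g (g' c) c) (he : ∀ c, 0 < c → c • g' c = (2 : ℝ) • g c)
    {c : ℝ} (hc : 0 < c) : g c = c ^ 2 • g 1 := by
  have hd : ∀ a : ℝ, 0 < a → HasDerivAt (fun a => (a ^ 2)⁻¹ • g a) 0 a := by
    intro a ha
    have h1 : HasDerivAt (fun a : ℝ => (a ^ 2)⁻¹) (-(2 * a) / (a ^ 2) ^ 2) a := by
      have := (hasDerivAt_pow 2 a).inv (by positivity)
      simp only [Nat.cast_ofNat, Nat.add_one_sub_one, pow_one] at this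
      exact this
    have h2 := h1.smul (hg a ha)
    have h3 : g' a = a⁻¹ • (2 : ℝ) • g a := by
      rw [← he a ha, smul_smul, inv_mul_cancel₀ ha.ne', one_smul]
    have h4 : (a ^ 2)⁻¹ • g' a + (-(2 * a) / (a ^ 2) ^ 2) • g a = 0 := by
      rw [h3, smul_smul, smul_smul, ← add_smul]
      have : (a ^ 2)⁻¹ * a⁻¹ * 2 + -(2 * a) / (a ^ 2) ^ 2 = 0 := by
        field_simp
        ring
      rw [this, zero_smul]
    rw [h4] at h2
    exact h2
  have hconst := isOpen_Ioi.is_const_of_deriv_eq_zero (isPreconnected_Ioi (a := (0 : ℝ)))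
    (fun a ha => (hd a ha).differentiableAt.differentiableWithinAt) (fun a ha => (hd a ha).deriv)
    (Set.mem_Ioi.2 hc) (Set.mem_Ioi.2 one_pos)
  simp only [one_pow, inv_one, one_smul] at hconst
  rw [← hconst, smul_smul, mul_inv_cancel₀ (by positivity), one_smul]

theorem eventually_snd_ne_zero {q : X.T.M} (hq : q.snd ≠ 0) : ∀ᶠ η in 𝓝 q, η.snd ≠ 0 :=
  isOpen_snd_ne_zero.mem_nhds hq

theorem chartField_fst
    (hsec : ∀ ξ : X.T.M, ξ.snd ≠ 0 → (S ξ).proj = ξ)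
    (hso : ∀ ξ : X.T.M, ξ.snd ≠ 0 → (canonicalFlip (S ξ)).proj = ξ)
    {q : X.T.M} (hq : q.snd ≠ 0) :
    ∀ᶠ z in 𝓝 (extChartAt X.T.I q q), (chartField S q z).1 = z.2 := by
  filter_upwards [extChartAt_target_mem_nhds (I := X.T.I) q,
    (tendsto_extChartAt_symm (X := X.T) q).eventually (eventually_snd_ne_zero hq)] with z h1 h2
  have h3 := (mem_chart_source_T _ _).1 ((extChartAt X.T.I q).map_target h1)
  have h4 := hsec _ h2
  refine (extChartAt_secondOrder (⟨q, 0⟩ : X.T.T.M) _ (by rw [h4]; exact h3)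
    (by rw [h4]; exact hso _ h2)).trans ?_
  rw [h4]
  exact congrArg Prod.snd ((extChartAt X.T.I q).right_inv h1)

theorem differentiableAt_chartField
    (hs : ContMDiffOn X.T.I X.T.T.I ∞ S {ξ | ξ.snd ≠ 0})
    (hsec : ∀ ξ : X.T.M, ξ.snd ≠ 0 → (S ξ).proj = ξ) {q : X.T.M} (hq : q.snd ≠ 0) :
    DifferentiableAt ℝ (chartField S q) (extChartAt X.T.I q q) := by
  have h1 : ContMDiffAt 𝓘(ℝ, X.E × X.E) X.T.I ∞ (extChartAt X.T.I q).symm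
      (extChartAt X.T.I q q) :=
    (contMDiffOn_extChartAt_symm q).contMDiffAt (extChartAt_target_mem_nhds q)
  have h2 : ContMDiffAt X.T.I X.T.T.I ∞ S ((extChartAt X.T.I q).symm (extChartAt X.T.I q q)) := by
    rw [extChartAt_to_inv]
    exact hs.contMDiffAt (isOpen_snd_ne_zero.mem_nhds hq)
  have h4 := contDiffAt_chart (X := X.T.T) (h2.comp (extChartAt X.T.I q q) h1)
    (⟨q, 0⟩ : X.T.T.M) (by
      refine (mem_chart_source_T (X := X.T) _ _).2 ?_
      rw [Function.comp_apply, extChartAt_to_inv, hsec q hq]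
      exact mem_extChartAt_source q)
  have h5 : DifferentiableAt ℝ (fun z => extChartAt X.T.T.I (⟨q, 0⟩ : X.T.T.M)
      (S ((extChartAt X.T.I q).symm z))) (extChartAt X.T.I q q) := h4.differentiableAt (by simp)
  exact h5.snd

theorem eq_mk_chartField (hsec : ∀ ξ : X.T.M, ξ.snd ≠ 0 → (S ξ).proj = ξ) {q : X.T.M}
    (hq : q.snd ≠ 0) : S q = (⟨q, chartField S q (extChartAt X.T.I q q)⟩ : X.T.T.M) := by
  obtain ⟨w, hw⟩ := exists_mk_of_proj (X := X.T) (hsec q hq)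
  have h1 : chartField S q (extChartAt X.T.I q q) = w := by
    unfold chartField
    rw [extChartAt_to_inv, hw]
    exact congrArg Prod.snd (extChartAt_self_T (X := X.T) q w 0)
  rw [h1]
  exact hw

/-- Euler's identity for the fibre part of a spray. -/
theorem euler_chartField
    (hsec : ∀ ξ : X.T.M, ξ.snd ≠ 0 → (S ξ).proj = ξ) {q : X.T.M} (hq : q.snd ≠ 0)
    (hb : VectorField.mlieBracket X.T.I
      (fun η => vecAt (X := X.T) η (liouville η)) (fun η => vecAt (X := X.T) η (S η)) q =
        vecAt (X := X.T) q (S q)) :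
    fderiv ℝ (chartField S q) (extChartAt X.T.I q q) ((0 : X.E), (extChartAt X.T.I q q).2) =
      chartField S q (extChartAt X.T.I q q) +
        ((0 : X.E), (chartField S q (extChartAt X.T.I q q)).2) := by
  have hbr := lieBracket_chart (X := X.T) q liouville S
    (fun z : X.E × X.E => ((0 : X.E), z.2)) (chartField S q)
    (Eventually.of_forall liouville_proj) ((eventually_snd_ne_zero hq).mono hsec)
    (by
      filter_upwards [extChartAt_target_mem_nhds (I := X.T.I) q] with z h1
      have h3 := (mem_chart_source_T _ _).1 ((extChartAt X.T.I q).map_target h1)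
      refine (extChartAt_liouville (⟨q, 0⟩ : X.T.T.M) _ h3).trans ?_
      exact congrArg (fun w : X.E × X.E => ((0 : X.E), w.2)) ((extChartAt X.T.I q).right_inv h1))
    (Eventually.of_forall fun _ => rfl) hb
  have hV : HasFDerivAt (fun z : X.E × X.E => ((0 : X.E), z.2))
      ((0 : X.E × X.E →L[ℝ] X.E).prod (ContinuousLinearMap.snd ℝ X.E X.E))
      (extChartAt X.T.I q q) :=
    (hasFDerivAt_const _ _).prodMk hasFDerivAt_snd
  -- The bracket written out as `DG(E) - DE(G)`, with `G` the fibre part of `S` and `E(x, y) = (0,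
  -- y)`.
  have hbr' : fderiv ℝ (chartField S q) (extChartAt X.T.I q q)
      ((0 : X.E), (extChartAt X.T.I q q).2) -
      fderiv ℝ (fun z : X.E × X.E => ((0 : X.E), z.2)) (extChartAt X.T.I q q)
        (chartField S q (extChartAt X.T.I q q)) = chartField S q (extChartAt X.T.I q q) := hbr
  rw [hV.fderiv, sub_eq_iff_eq_add] at hbr'
  exact hbr'

/-- The consequences of the spray axioms in the chart at `q`, along the fibre of `q`. -/
theorem chartField_along_fibre
    (hs : ContMDiffOn X.T.I X.T.T.I ∞ S {ξ | ξ.snd ≠ 0})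
    (hsec : ∀ ξ : X.T.M, ξ.snd ≠ 0 → (S ξ).proj = ξ)
    (hso : ∀ ξ : X.T.M, ξ.snd ≠ 0 → (canonicalFlip (S ξ)).proj = ξ)
    (hb : ∀ ξ : X.T.M, ξ.snd ≠ 0 → VectorField.mlieBracket X.T.I
      (fun η => vecAt (X := X.T) η (liouville η)) (fun η => vecAt (X := X.T) η (S η)) ξ =
        vecAt (X := X.T) ξ (S ξ))
    (x : X.M) (y : X.E) (hy : y ≠ 0) (G : X.E × X.E → X.E × X.E)
    (hG : G = chartField S (⟨x, 0⟩ : X.T.M)) :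
    DifferentiableAt ℝ G (extChartAt X.I x x, y) ∧
    S (⟨x, y⟩ : X.T.M) = (⟨⟨x, y⟩, G (extChartAt X.I x x, y)⟩ : X.T.T.M) ∧
    (G (extChartAt X.I x x, y)).1 = y ∧
    fderiv ℝ G (extChartAt X.I x x, y) ((0 : X.E), y) =
      G (extChartAt X.I x x, y) + ((0 : X.E), (G (extChartAt X.I x x, y)).2) := by
  have hG' : G = chartField S (⟨x, y⟩ : X.T.M) := hG.trans (chartField_congr rfl)
  have hq : (⟨x, y⟩ : X.T.M).snd ≠ 0 := hy
  have hz : extChartAt X.T.I (⟨x, y⟩ : X.T.M) (⟨x, y⟩ : X.T.M) = (extChartAt X.I x x, y) :=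
    extChartAt_self_T x y y
  have h1 := differentiableAt_chartField hs hsec hq
  have h2 := eq_mk_chartField hsec hq
  have h3 := (chartField_fst hsec hso hq).self_of_nhds
  have h4 := euler_chartField hsec hq (hb _ hq)
  rw [← hG', hz] at h1 h2 h3 h4
  exact ⟨h1, h2, h3, h4⟩

/-- The second order condition makes the first fibre component equal to `y`, and Euler's identity
makes the second quadratic under positive scaling. Together they give `S(x, Cy) = (x, Cy; Cy, C²
G₂(x, y))`, which is `C · Dm_C(S(x, y))`. -/
theorem isHomogeneousField_of_bracket
    (hs : ContMDiffOn X.T.I X.T.T.I ∞ S {ξ | ξ.snd ≠ 0})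
    (hsec : ∀ ξ : X.T.M, ξ.snd ≠ 0 → (S ξ).proj = ξ)
    (hso : ∀ ξ : X.T.M, ξ.snd ≠ 0 → (canonicalFlip (S ξ)).proj = ξ)
    (hb : ∀ ξ : X.T.M, ξ.snd ≠ 0 → VectorField.mlieBracket X.T.I
      (fun η => vecAt (X := X.T) η (liouville η)) (fun η => vecAt (X := X.T) η (S η)) ξ =
        vecAt (X := X.T) ξ (S ξ)) :
    IsHomogeneousField {ξ : X.T.M | ξ.snd ≠ 0} S where
  isOpen := isOpen_snd_ne_zero
  smooth := hs
  smul_mem _ hC _ hξ := smul_ne_zero hC.ne' hξ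
  map_smul C hC ξ hξ := by
    obtain ⟨x, y⟩ := ξ
    change X.E at y
    have hy : y ≠ 0 := hξ
    obtain ⟨G, hG⟩ : ∃ G, G = chartField S (⟨x, 0⟩ : X.T.M) := ⟨_, rfl⟩
    have key := fun y hy => chartField_along_fibre hs hsec hso hb x y hy G hG
    have hCy : C • y ≠ 0 := smul_ne_zero hC.ne' hy
    have h2 : (G (extChartAt X.I x x, C • y)).2 =
        C ^ 2 • (G (extChartAt X.I x x, y)).2 := by
      -- Here `g` is the second fibre component along the ray `c ↦ (x, c y)`. The factor 2 comes
      -- from its appearing twice on the right of Euler's identity.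
      have := eq_sq_smul_of_euler (g := fun c => (G (extChartAt X.I x x, c • y)).2)
        (g' := fun c => (fderiv ℝ G (extChartAt X.I x x, c • y) (0, y)).2)
        (fun c hc => by
          have h1 := (key (c • y) (smul_ne_zero hc.ne' hy)).1.hasFDerivAt
          have h2 : HasDerivAt (fun c : ℝ => (extChartAt X.I x x, c • y)) ((0 : X.E), y) c := by
            have := (hasDerivAt_const c (extChartAt X.I x x)).prodMk
              ((hasDerivAt_id c).smul_const y)
            rwa [one_smul] at this
          have h3 : HasDerivAt (fun c : ℝ => G (extChartAt X.I x x, c • y)) _ c :=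
            HasFDerivAt.comp_hasDerivAt (l := G)
              (f := fun c : ℝ => (extChartAt X.I x x, c • y)) c h1 h2
          exact (ContinuousLinearMap.snd ℝ X.E X.E).hasFDerivAt.comp_hasDerivAt c h3)
        (fun c hc => by
          have h1 := (key (c • y) (smul_ne_zero hc.ne' hy)).2.2.2
          have h2 : ((0 : X.E), c • y) = c • ((0 : X.E), y) := by simp
          rw [h2, _root_.map_smul] at h1
          have h3 := congrArg Prod.snd h1
          rw [two_smul]
          exact h3) hC
      simpa using this
    have e1 : S (⟨x, C • y⟩ : X.T.M) =
        (⟨⟨x, C • y⟩, (C • y, C ^ 2 • (G (extChartAt X.I x x, y)).2)⟩ : X.T.T.M) := by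
      obtain ⟨-, h3, h4, -⟩ := key (C • y) hCy
      rw [h3]
      congr 1
      exact Prod.ext h4 h2
    obtain ⟨-, h3, h4, -⟩ := key y hy
    refine e1.trans ?_
    rw [D_smul, h3]
    have h5 : C • (y, C • (G (extChartAt X.I x x, y)).2) =
        (C • y, C ^ 2 • (G (extChartAt X.I x x, y)).2) := by
      rw [Prod.smul_mk, smul_smul, sq]
    rw [← h5]
    change _ = (⟨⟨x, C • y⟩, C • ((G (extChartAt X.I x x, y)).1,
      C • (G (extChartAt X.I x x, y)).2)⟩ : X.T.T.M)
    rw [h4]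

end BaseSpray

/-! ### Specialisation to `T^r X` -/

section IteratedLifts

variable (X : Mfd.{u})

theorem contMDiff_projBase (r : ℕ) : ContMDiff (X.iter r).I X.I ∞ (projBase X r) := by
  induction r with
  | zero => exact contMDiff_id
  | succ r ih => exact ih.comp (contMDiff_proj (X := X.iter r))

theorem slashed_one : slashed X 1 = {ξ : X.T.M | ξ.snd ≠ 0} := by
  ext ξ
  have : D (X := X) (Y := X) id ξ = ξ := by
    unfold D
    rw [tangentMap_id]
    rfl
  change (D (X := X) (Y := X) id ξ).snd ≠ 0 ↔ _
  rw [this]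
  rfl

/-- By the chain rule the tangent map of `T^{r+1} X → X` factors through `Dπ_r`, which is `π ∘ κ`;
hence the slashed bundles are exactly the successive domains of the complete lifts. -/
theorem slashed_succ (r : ℕ) : slashed X (r + 2) = liftSet (X := X.iter r) (slashed X (r + 1)) := by
  have h : ∀ ξ : (X.iter r).T.T.M, D (X := (X.iter r).T) (Y := X) (projBase X (r + 1)) ξ =
      D (X := X.iter r) (Y := X) (projBase X r) (canonicalFlip ξ).proj := by
    intro ξ
    rw [← D_proj]
    exact D_comp_apply (X := (X.iter r).T) (Y := X.iter r) (Z := X) ξ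
      ((contMDiff_projBase X r).contMDiffAt.mdifferentiableAt (by simp))
      (contMDiff_proj.contMDiffAt.mdifferentiableAt (by simp))
  ext ξ
  change (D (X := (X.iter r).T) (Y := X) (projBase X (r + 1)) ξ).snd ≠ 0 ↔
    (D (X := X.iter r) (Y := X) (projBase X r) (canonicalFlip (X := X.iter r) ξ).proj).snd ≠ 0
  have h1 := h ξ
  -- The type of a fibre component depends on its base point, so the whole vector is replaced at
  -- once.
  generalize D (X := (X.iter r).T) (Y := X) (projBase X (r + 1)) ξ = a at h1 ⊢
  subst h1
  rfl

variable {X} {S : (X.iter 1).M → (X.iter 2).M}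

theorem IsSpray.isHomogeneousField (hS : IsSpray X 0 S) :
    IsHomogeneousField (X := X) (slashed X 1) S := by
  obtain ⟨h1, h2, h3, h4⟩ := hS
  rw [slashed_one] at *
  refine isHomogeneousField_of_bracket h1 h2 (fun ξ hξ => ?_) h4
  exact (D_proj (X := X) (S ξ)).symm.trans (h3 ξ hξ)

theorem IsSpray.isHomogeneousField_iterLift (hS : IsSpray X 0 S) (r : ℕ) :
    IsHomogeneousField (X := X.iter r) (slashed X (r + 1)) (iterLift X S r) := by
  induction r with
  | zero => exact hS.isHomogeneousField
  | succ r ih =>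
    rw [slashed_succ]
    exact ih.lift

theorem isGeodesic_iff {r : ℕ} {I : Set ℝ} {γ : ℝ → (X.iter r).M}
    {S : (X.iter (r + 1)).M → (X.iter (r + 2)).M} :
    IsGeodesic X r S I γ ↔ IsGeo (X := X.iter r) (slashed X (r + 1)) S I γ :=
  ⟨fun h => ⟨h.1, h.2, h.3, h.4, h.5⟩, fun h => ⟨h.1, h.2, h.3, h.4, h.5⟩⟩

theorem isGeodesic_succ_iff {r : ℕ} {I : Set ℝ} {γ : ℝ → (X.iter (r + 1)).M} :
    IsGeodesic X (r + 1) (iterLift X S (r + 1)) I γ ↔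
      IsGeo (X := (X.iter r).T) (liftSet (slashed X (r + 1))) (lift (iterLift X S r)) I γ := by
  rw [isGeodesic_iff, slashed_succ]
  exact Iff.rfl

theorem isGeodesic_succ_succ_iff {r : ℕ} {I : Set ℝ} {γ : ℝ → (X.iter (r + 2)).M} :
    IsGeodesic X (r + 2) (iterLift X S (r + 2)) I γ ↔
      IsGeo (X := (X.iter r).T.T) (liftSet (X := (X.iter r).T) (liftSet (slashed X (r + 1))))
        (lift (X := (X.iter r).T) (lift (iterLift X S r))) I γ := by
  rw [isGeodesic_succ_iff, slashed_succ]
  exact Iff.rfl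

theorem IsGeodesic.kappa (hS : IsSpray X 0 S) {r : ℕ} {I : Set ℝ} {j : ℝ → (X.iter (r + 1)).M}
    (hj : IsGeodesic X (r + 1) (iterLift X S (r + 1)) I j) :
    IsGeodesic X (r + 1) (iterLift X S (r + 1)) I
      (fun t => IteratedTangent.kappa X (r + 1) (j t)) := by
  cases r with
  | zero => exact hj
  | succ r =>
    rw [isGeodesic_succ_succ_iff] at hj ⊢
    exact hj.flip (hS.isHomogeneousField_iterLift r)

theorem IsGeodesic.proj {r : ℕ} {I : Set ℝ} {j : ℝ → (X.iter (r + 1)).M}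
    (hj : IsGeodesic X (r + 1) (iterLift X S (r + 1)) I j) :
    IsGeodesic X r (iterLift X S r) I (fun t => IteratedTangent.proj X r (j t)) :=
  isGeodesic_iff.2 (isGeodesic_succ_iff.1 hj).proj

end IteratedLifts

end IteratedTangent

end

open IteratedTangent

theorem mainTheorem10 {n : ℕ} {M : Type*} [TopologicalSpace M] [T2Space M]
    [SecondCountableTopology M] [ChartedSpace (EuclideanSpace ℝ (Fin n)) M]
    [IsManifold (𝓡 n) ∞ M]
    (S : ((ofManifold n M).iter 1).M → ((ofManifold n M).iter 2).M)
    (hS : IsSpray (ofManifold n M) 0 S) :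
    -- affine reparametrizations
    (∀ (r : ℕ) (I : Set ℝ) (j : ℝ → ((ofManifold n M).iter r).M) (t₀ C : ℝ), 0 < C →
      IsGeodesic (ofManifold n M) r (iterLift _ S r) I j →
      IsGeodesic (ofManifold n M) r (iterLift _ S r) {t | C * t + t₀ ∈ I}
        (fun t => j (C * t + t₀))) ∧
    -- linear combinations
    (∀ (r : ℕ) (I : Set ℝ) (j k : ℝ → ((ofManifold n M).iter (r + 1)).M) (α β : ℝ),
      IsGeodesic (ofManifold n M) (r + 1) (iterLift _ S (r + 1)) I j →
      IsGeodesic (ofManifold n M) (r + 1) (iterLift _ S (r + 1)) I k →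
      (∀ t ∈ I, proj (ofManifold n M) r (j t) = proj (ofManifold n M) r (k t)) →
      IsGeodesic (ofManifold n M) (r + 1) (iterLift _ S (r + 1)) I
        (fun t => fibreComb α β (j t) (k t))) ∧
    -- the canonical involution
    (∀ (r : ℕ) (I : Set ℝ) (j : ℝ → ((ofManifold n M).iter (r + 1)).M),
      IsGeodesic (ofManifold n M) (r + 1) (iterLift _ S (r + 1)) I j →
      IsGeodesic (ofManifold n M) (r + 1) (iterLift _ S (r + 1)) I
        (fun t => kappa (ofManifold n M) (r + 1) (j t))) ∧
    -- the projection `π_{r-1}`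
    (∀ (r : ℕ) (I : Set ℝ) (j : ℝ → ((ofManifold n M).iter (r + 1)).M),
      IsGeodesic (ofManifold n M) (r + 1) (iterLift _ S (r + 1)) I j →
      IsGeodesic (ofManifold n M) r (iterLift _ S r) I
        (fun t => proj (ofManifold n M) r (j t))) ∧
    -- the projection `Dπ_{r-2}`
    (∀ (r : ℕ) (I : Set ℝ) (j : ℝ → ((ofManifold n M).iter (r + 2)).M),
      IsGeodesic (ofManifold n M) (r + 2) (iterLift _ S (r + 2)) I j →
      IsGeodesic (ofManifold n M) (r + 1) (iterLift _ S (r + 1)) I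
        (fun t => D (proj (ofManifold n M) r) (j t))) ∧
    -- the tangent `j'`
    (∀ (r : ℕ) (I : Set ℝ) (j : ℝ → ((ofManifold n M).iter r).M),
      IsGeodesic (ofManifold n M) r (iterLift _ S r) I j →
      IsGeodesic (ofManifold n M) (r + 1) (iterLift _ S (r + 1)) I (tangent j)) ∧
    -- the curve `t j'(t)`
    (∀ (r : ℕ) (I : Set ℝ) (j : ℝ → ((ofManifold n M).iter r).M),
      IsGeodesic (ofManifold n M) r (iterLift _ S r) I j →
      IsGeodesic (ofManifold n M) (r + 1) (iterLift _ S (r + 1)) I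
        (fun t => fibreSMul t (tangent j t))) ∧
    -- the curve `E_r ∘ j`
    (∀ (r : ℕ) (I : Set ℝ) (j : ℝ → ((ofManifold n M).iter (r + 1)).M),
      IsGeodesic (ofManifold n M) (r + 1) (iterLift _ S (r + 1)) I j →
      IsGeodesic (ofManifold n M) (r + 2) (iterLift _ S (r + 2)) I
        (fun t => liouvilleField (ofManifold n M) r (j t))) := by
  have hr := hS.isHomogeneousField_iterLift
  refine ⟨fun r I j t₀ C hC hj => ?_, fun r I j k α β hj hk h => ?_, fun r I j hj => hj.kappa hS,
    fun r I j hj => hj.proj, fun r I j hj => ?_, fun r I j hj => ?_, fun r I j hj => ?_,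
    fun r I j hj => ?_⟩
  · exact isGeodesic_iff.2 ((isGeodesic_iff.1 hj).affine (hr r) t₀ hC)
  · exact isGeodesic_succ_iff.2 ((isGeodesic_succ_iff.1 hj).fibreComb α β
      (isGeodesic_succ_iff.1 hk) h)
  · have h1 : ∀ ξ : ((ofManifold n M).iter r).T.T.M,
        D (X := ((ofManifold n M).iter r).T) (Y := (ofManifold n M).iter r)
          (proj (ofManifold n M) r) ξ = (canonicalFlip ξ).proj := D_proj
    have h2 : (fun t => D (X := ((ofManifold n M).iter r).T) (Y := (ofManifold n M).iter r)
        (proj (ofManifold n M) r) (j t)) = fun t => (canonicalFlip (j t)).proj :=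
      funext fun t => h1 (j t)
    -- As `Dπ = π ∘ κ`, the curve is the projection of the flipped geodesic.
    have h3 := (IsGeodesic.kappa hS hj).proj
    rw [show (fun t => D (proj (ofManifold n M) r) (j t)) = _ from h2]
    exact h3
  · exact isGeodesic_succ_iff.2 ((isGeodesic_iff.1 hj).tangent (hr r))
  · exact isGeodesic_succ_iff.2 ((isGeodesic_iff.1 hj).smul_tangent (hr r))
  · exact isGeodesic_succ_succ_iff.2 ((isGeodesic_succ_iff.1 hj).liouville (hr r))
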